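/- Let $k$ be a field, $E$ a finite dimensional $k$-vector space of dimension $r$, $N$ a free abelian group of finite rank, and $N_\mathbb{R}=N\otimes\mathbb{R}$. Definitions. A \emph{fan} in $N_\mathbb{R}$ is a finite set of strictly convex, finitely generated (not necessarily rational) real cones that contains every face of each of its members and in which any two cones meet along a common face. A fan is \emph{complete} if the union of its cones is $N_\mathbb{R}$, and \emph{rational} if each of its cones is generated by finitely many points of $N$. A \emph{subdivision} of a fan $\Sigma$ is a fan with the same support each of whose cones lies in a cone of $\Sigma$. For a complete fan $\Sigma$, $\operatorname{PL}(\Sigma,\mathbb{R})$ is the set of functions $N_\mathbb{R}\to\mathbb{R}$ that are linear on each cone of $\Sigma$; $\operatorname{PL}(N_\mathbb{R},\mathbb{R})$ is the union of these sets over all complete fans; $\operatorname{PL}(\Sigma,\mathbb{Z})$ and $\operatorname{PL}(N,\mathbb{Z})$ are the subsets of functions with integer values on $N$. All these sets are ordered pointwise and enlarged by a largest element $\infty$, regarded as the function with constant value $\infty$. If $\Gamma$ is a meet-semilattice with largest element $\infty$, a \emph{valuation} $v:E\to\Gamma$ is a map such that $v(ce)=v(e)$ for $0\ne c\in k$, $v(e_1+e_2)\ge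 v(e_1)\wedge v(e_2)$, and $v(e)=\infty$ if and only if $e=0$. It is \emph{finite} if the semilattice generated by its image is finite. A \emph{finite piecewise linear valuation} is a finite valuation $\mathfrak{v}:E\to\operatorname{PL}(N_\mathbb{R},\mathbb{R})$, where the meet is the pointwise minimum; it is \emph{integral} if its values lie in $\operatorname{PL}(N,\mathbb{Z})$. Let $\tilde{\mathfrak{B}}(E)$ be the set of all valuations $E\to\mathbb{R}\cup\{\infty\}$, and $\tilde{\mathfrak{B}}_\mathbb{Z}(E)$ the subset of those with values in $\mathbb{Z}\cup\{\infty\}$. For a frame $L$, that is, a decomposition $E=L_1\oplus\cdots\oplus L_r$ into lines, the extended apartment $\tilde A(L)$ is the set of $v\in\tilde{\mathfrak{B}}(E)$ such that each subspace $\{e: v(e)\ge a\}$, $a \in \mathbb{R}$, is a sum of some of the $L_i$; it is identified with $\mathbb{R}^r$ by $v\mapsto(v(L_1),\dots,v(L_r))$, where $v(L_i)$ is the value of $v$ on $L_i\setminus\{0\}$. A map $\Phi:N_\mathbb{R}\to\tilde{\mathfrak{B}}(E)$ is \emph{piecewise linear} with respect to a complete fan $\Sigma$ if for each $\sigma\in\Sigma$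 there is a frame $L$ with $\Phi(\sigma)\subset\tilde A(L)$ such that $\Phi|_\sigma:\sigma\to\tilde A(L)\cong\mathbb{R}^r$ is the restriction of a linear map $N_\mathbb{R}\to\mathbb{R}^r$. It is \emph{integral} if $\Phi(N)\subset\tilde{\mathfrak{B}}_\mathbb{Z}(E)$. For a map $\Phi:N_\mathbb{R}\to\tilde{\mathfrak{B}}(E)$ put $\mathfrak{v}_\Phi(e)(x)=\Phi(x)(e)$ for $e\neq 0$ and $\mathfrak{v}_\Phi(0)=\infty$. For a finite piecewise linear valuation $\mathfrak{v}$ put $\Phi_\mathfrak{v}(x)(e)=\mathfrak{v}(e)(x)$. Theorem. (1) Let $\Phi$ be piecewise linear with respect to a complete fan $\Sigma$. Then $\mathfrak{v}_\Phi$ is a finite piecewise linear valuation. In fact there is a subdivision $\Sigma'$ of $\Sigma$ such that $\mathfrak{v}_\Phi:E\to\operatorname{PL}(\Sigma',\mathbb{R})$. If $\Phi$ is integral, then moreover $\mathfrak{v}_\Phi:E\to\operatorname{PL}(\Sigma',\mathbb{Z})$, and if in addition $\Sigma$ is rational, then $\Sigma'$ can be taken rational. (2) Let $\mathfrak{v}$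 be a finite piecewise linear valuation. Then $\Phi_\mathfrak{v}(x)$ is a valuation $E\to\mathbb{R}\cup\{\infty\}$ for every $x\in N_\mathbb{R}$, and there is a complete fan $\Sigma$ such that $\Phi_\mathfrak{v}:N_\mathbb{R}\to\tilde{\mathfrak{B}}(E)$ is piecewise linear with respect to $\Sigma$. If $\mathfrak{v}$ is integral, $\Sigma$ can be taken rational. (3) The maps $\Phi\mapsto\mathfrak{v}_\Phi$ and $\mathfrak{v}\mapsto\Phi_\mathfrak{v}$ are mutually inverse bijections between the set of maps $\Phi:N_\mathbb{R}\to\tilde{\mathfrak{B}}(E)$ that are piecewise linear with respect to some complete fan and the set of finite piecewise linear valuations $\mathfrak{v}:E\to\operatorname{PL}(N_\mathbb{R},\mathbb{R})$. They restrict to mutually inverse bijections between the integral piecewise linear maps and the integral finite piecewise linear valuations $\mathfrak{v}:E\to\operatorname{PL}(N,\mathbb{Z})$. -/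

import Mathlib

open scoped TensorProduct

namespace ToricPL

section Cones

variable {V : Type*} [AddCommGroup V] [Module ℝ V]

/-- A (finite, polyhedral) fan in the real vector space `V`: a finite set of strictly convex,
finitely generated cones, closed under taking faces, in which any two cones meet along a common
face. The cones are not required to be rational; see `Fan.IsRational`. -/
structure Fan (V : Type*) [AddCommGroup V] [Module ℝ V] where
  cones : Set (PointedCone ℝ V)
  finite : cones.Finite
  fg : ∀ σ ∈ cones, ∃ s : Finset V, σ = PointedCone.hull ℝ (s : Set V)
  salient : ∀ σ ∈ cones, ∀ x ∈ σ, -x ∈ σ → x = 0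
  face_mem : ∀ σ ∈ cones, ∀ τ : PointedCone ℝ V, τ.IsFaceOf σ → τ ∈ cones
  inf_isFaceOf : ∀ σ ∈ cones, ∀ τ ∈ cones, (σ ⊓ τ).IsFaceOf σ ∧ (σ ⊓ τ).IsFaceOf τ

/-- The support `|Σ|` of a fan: the union of its cones. -/
def Fan.support (S : Fan V) : Set V := ⋃ σ ∈ S.cones, (σ : Set V)

/-- A fan is complete if its support is the whole space. -/
def Fan.IsComplete (S : Fan V) : Prop := S.support = Set.univ

/-- `S'` is a subdivision (refinement) of `S`: the two fans have the same support, and each cone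
of `S'` is contained in a cone of `S`. -/
def Fan.IsSubdivision (S' S : Fan V) : Prop :=
  S'.support = S.support ∧ ∀ σ' ∈ S'.cones, ∃ σ ∈ S.cones, σ' ≤ σ

/-- The set `PL(Σ, ℝ)` of functions that are linear on each cone of the fan `S`. -/
def PLOn (S : Fan V) : Set (V → ℝ) :=
  {h | ∀ σ ∈ S.cones, ∃ u : V →ₗ[ℝ] ℝ, ∀ x ∈ σ, h x = u x}

/-- The set `PL(V, ℝ)` of functions that are piecewise linear with respect to some complete fan. -/
def PL (V : Type*) [AddCommGroup V] [Module ℝ V] : Set (V → ℝ) :=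
  {h | ∃ S : Fan V, S.IsComplete ∧ h ∈ PLOn S}

/-- Adjoin to a set of real functions on `V` the infinity element `⊤`, which is larger than every
function. The order on `WithTop (V → ℝ)` is pointwise comparison and the meet is pointwise `min`. -/
def withInfinity (F : Set (V → ℝ)) : Set (WithTop (V → ℝ)) :=
  insert ⊤ ((fun h : V → ℝ => (h : WithTop (V → ℝ))) '' F)

end Cones

section Lattice

/-- `N_ℝ = ℝ ⊗ N`. -/
abbrev NR (N : Type*) [AddCommGroup N] : Type _ := ℝ ⊗[ℤ] N

variable {N : Type*} [AddCommGroup N]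

/-- The lattice point of `N_ℝ` given by `n ∈ N`. -/
def latticePt (n : N) : NR N := (1 : ℝ) ⊗ₜ[ℤ] n

/-- A fan in `N_ℝ` is rational if each of its cones is generated by finitely many points of `N`. -/
def Fan.IsRational (S : Fan (NR N)) : Prop :=
  ∀ σ ∈ S.cones, ∃ s : Finset N, σ = PointedCone.hull ℝ (latticePt '' (s : Set N))

/-- The functions on `N_ℝ` that take integer values on `N`. -/
def integralOnLattice (N : Type*) [AddCommGroup N] : Set (NR N → ℝ) :=
  {h | ∀ n : N, ∃ m : ℤ, h (latticePt n) = m}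

/-- `PL(Σ, ℤ)`. -/
def PLOnInt (S : Fan (NR N)) : Set (NR N → ℝ) := PLOn S ∩ integralOnLattice N

/-- `PL(N, ℤ)`. -/
def PLInt (N : Type*) [AddCommGroup N] : Set (NR N → ℝ) := PL (NR N) ∩ integralOnLattice N

end Lattice

section Valuations

variable (k : Type*) [Field k] {E : Type*} [AddCommGroup E] [Module k E]

/-- A valuation on the `k`-vector space `E` with values in a meet-semilattice `Γ` with maximum `⊤`. -/
structure IsValuation {Γ : Type*} [SemilatticeInf Γ] [OrderTop Γ] (v : E → Γ) : Prop where
  map_smul : ∀ (c : k) (e : E), c ≠ 0 → v (c • e) = v e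
  inf_le_map_add : ∀ e₁ e₂ : E, v e₁ ⊓ v e₂ ≤ v (e₁ + e₂)
  eq_top_iff : ∀ e : E, v e = ⊤ ↔ e = 0

/-- The extended Tits building of `GL(E)`: the set of all valuations `E → ℝ ∪ {∞}`. -/
def ExtBuilding (E : Type*) [AddCommGroup E] [Module k E] : Type _ :=
  {v : E → WithTop ℝ // IsValuation k v}

/-- The integral points of the extended building: valuations with values in `ℤ ∪ {∞}`. -/
def integralPoints (E : Type*) [AddCommGroup E] [Module k E] : Set (ExtBuilding k E) :=
  {v | ∀ e : E, v.1 e = ⊤ ∨ ∃ m : ℤ, v.1 e = ((m : ℝ) : WithTop ℝ)}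

/-- A frame of `E`: a decomposition of `E` as a direct sum of lines. -/
structure Frame (E : Type*) [AddCommGroup E] [Module k E] where
  line : Fin (Module.finrank k E) → Submodule k E
  finrank_line : ∀ i, Module.finrank k (line i) = 1
  isInternal : DirectSum.IsInternal line

variable {k}

/-- The extended apartment of the frame `L`: the valuations `v` adapted to `L`, that is, such that
each subspace `{e | v e ≥ a}` is the sum of some of the lines of `L`. -/
def Frame.apartment (L : Frame k E) : Set (ExtBuilding k E) :=
  {v | ∀ a : ℝ, ∃ J : Set (Fin (Module.finrank k E)),
    {e : E | (a : WithTop ℝ) ≤ v.1 e} = ((⨆ i ∈ J, L.line i : Submodule k E) : Set E)}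

/-- `a` is the coordinate tuple of `v`: `v` takes the value `a i` on the nonzero vectors of the
line `L i`. This is the identification of the apartment of `L` with `ℝ^r`. -/
def Frame.HasCoords (L : Frame k E) (v : ExtBuilding k E)
    (a : Fin (Module.finrank k E) → ℝ) : Prop :=
  ∀ i, ∀ e ∈ L.line i, e ≠ 0 → v.1 e = (a i : WithTop ℝ)

variable {V : Type*} [AddCommGroup V] [Module ℝ V]

/-- `Φ` is piecewise linear with respect to the fan `S`: for each cone `σ` there is a frame `L` such
that `Φ` maps `σ` into the apartment of `L`, and `Φ` restricted to `σ` is, in the coordinates of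
that apartment, the restriction of a linear map `V → ℝ^r`. -/
def IsPLMapOn (S : Fan V) (Φ : V → ExtBuilding k E) : Prop :=
  ∀ σ ∈ S.cones, ∃ L : Frame k E, (∀ x ∈ σ, Φ x ∈ L.apartment) ∧
    ∃ u : V →ₗ[ℝ] (Fin (Module.finrank k E) → ℝ), ∀ x ∈ σ, L.HasCoords (Φ x) (u x)

/-- `Φ` is piecewise linear with respect to some complete fan. -/
def IsPLMap (Φ : V → ExtBuilding k E) : Prop :=
  ∃ S : Fan V, S.IsComplete ∧ IsPLMapOn S Φ

variable (k) in
/-- A finite piecewise linear valuation `v : E → PL(V, ℝ) ∪ {∞}`; finite means that the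
meet-semilattice generated by the image of `v` is finite. -/
structure IsFinitePLValuation (v : E → WithTop (V → ℝ)) : Prop where
  isValuation : IsValuation k v
  mem_PL : ∀ e, v e ∈ withInfinity (PL V)
  finite : (infClosure (Set.range v)).Finite

/-- The map `Φ` to the extended building sends lattice points to integral points. -/
def IsIntegralMap {N : Type*} [AddCommGroup N] (Φ : NR N → ExtBuilding k E) : Prop :=
  ∀ n : N, Φ (latticePt n) ∈ integralPoints k E

/-- The valuation `v` takes its values in `PL(N, ℤ) ∪ {∞}`. -/
def IsIntegralValuation {N : Type*} [AddCommGroup N] (v : E → WithTop (NR N → ℝ)) : Prop :=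
  ∀ e, v e ∈ withInfinity (PLInt N)

open Classical in
/-- The map `v_Φ`, with `v_Φ(e)(x) = Φ(x)(e)` for `e ≠ 0` and `v_Φ(0) = ∞`. -/
noncomputable def valuationOf (Φ : V → ExtBuilding k E) : E → WithTop (V → ℝ) := fun e =>
  if he : e = 0 then ⊤
  else ((fun x => ((Φ x).1 e).untop (fun h => he (((Φ x).2.eq_top_iff e).1 h)) : V → ℝ) :
    WithTop (V → ℝ))

/-- Evaluation of a function-valued `v` at `x`: the function `Φ_v(x)`, with `Φ_v(x)(e) = v(e)(x)`;
the element `∞` is evaluated to `∞`. -/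
def evalAt (v : E → WithTop (V → ℝ)) (x : V) : E → WithTop ℝ := fun e =>
  (v e).map (fun h : V → ℝ => h x)

end Valuations

end ToricPL

/-! Both directions rest on one refinement. Given finitely many linear functionals, cut the cones
along the hyperplanes where two of them agree; on each resulting cone the functionals are totally
ordered (`IsPrefan.exists_refine`).

From Φ to a valuation: in the apartment of a frame, the value of e is the minimum of the coordinates
at which e has a nonzero component (`Frame.exists_coords`). Once the coordinates are ordered on a
cone, this minimum is one of them, hence linear there. A value is determined by the choice of a
coordinate on each cone, so there are finitely many values, and finitely many meets
(`exists_subdivision`).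

From a valuation to Φ: each of the finitely many values is glued from finitely many linear
functionals. Cut the whole space by the differences of all of them. A value is continuous on lines,
so it cannot jump between ordered functionals inside a cone and agrees there with one of them
(`exists_eqOn_of_signConst`). The values are then totally ordered on each cone C, the subspaces of
vectors whose value is at least h on C, for h a value, form a finite chain, and a basis adapted to
this chain is a frame that works for all points of C at once (`exists_frame`).

The two constructions are inverse because both read the same function of x and e.

For rationality, the cones carry a set A containing their generators: a cut along l creates only
generators of the form `l a • b - l b • a`, which are lattice points when a and b are and l is
integral. The functionals are integral because they are taken on full-dimensional cones, where every
lattice vector is a difference of lattice points of the cone (`mem_integralOnLattice_of_full`).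
Prefans omit strict convexity because one of the cuttings starts from the whole space; there it is
recovered by cutting along the coordinate hyperplanes as well. -/

namespace ToricPL

/-! ### Finitely generated cones, their faces and their intersections with half-spaces -/

section Cones

variable {V : Type*} [AddCommGroup V] [Module ℝ V]

/-- The closed half-space on which a linear functional is nonnegative. -/
def halfSpace (l : V →ₗ[ℝ] ℝ) : PointedCone ℝ V := (PointedCone.positive ℝ ℝ).comap l

@[simp] lemma mem_halfSpace {l : V →ₗ[ℝ] ℝ} {x : V} : x ∈ halfSpace l ↔ 0 ≤ l x := Iff.rfl

/-- The set `A` contains the elimination combinations `l a • b - l b • a` of its members. -/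
def EliminationClosed (A : Set V) (l : V →ₗ[ℝ] ℝ) : Prop :=
  ∀ a ∈ A, ∀ b ∈ A, 0 < l a → l b < 0 → l a • b - l b • a ∈ A

/-- The cone `σ` is generated by a finite subset of `A`. -/
def GeneratedIn (A : Set V) (σ : PointedCone ℝ V) : Prop :=
  ∃ s : Finset V, (s : Set V) ⊆ A ∧ σ = PointedCone.hull ℝ (s : Set V)

lemma exists_coeff_of_mem_hull {s : Finset V} {x : V}
    (hx : x ∈ PointedCone.hull ℝ (s : Set V)) :
    ∃ c : V → ℝ, (∀ a, 0 ≤ c a) ∧ ∑ a ∈ s, c a • a = x := by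
  obtain ⟨f, -, hf⟩ := Submodule.mem_span_finset.1 hx
  exact ⟨fun a => (f a : ℝ), fun a => (f a).2, hf⟩

lemma sum_smul_mem {s : Finset V} {c : V → ℝ} (hc : ∀ a, 0 ≤ c a) {C : PointedCone ℝ V}
    (hs : ∀ a ∈ s, a ∈ C) : ∑ a ∈ s, c a • a ∈ C :=
  C.sum_mem fun a ha => C.smul_mem (hc a) (hs a ha)

/-- The intersection of a finitely generated cone with a half-space is finitely generated. -/
lemma GeneratedIn.inf_halfSpace {A : Set V} {σ : PointedCone ℝ V} (hσ : GeneratedIn A σ)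
    {l : V →ₗ[ℝ] ℝ} (hl : EliminationClosed A l) : GeneratedIn A (σ ⊓ halfSpace l) := by
  classical
  obtain ⟨s, hsA, rfl⟩ := hσ
  set s₀ := s.filter fun a => 0 ≤ l a with hs₀
  set s₁ := s.filter fun a => ¬ 0 ≤ l a with hs₁
  -- Besides the generators with l ≥ 0, each pair with l a > 0 > l b contributes the point where the
  -- cone spanned by a and b meets the hyperplane l = 0.
  set t := s₀ ∪ Finset.image₂ (fun a b => l a • b - l b • a) (s.filter fun a => 0 < l a) s₁ with ht
  -- The expression is linear in p, so generators suffice: it is a new generator if p comes from s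
  -- with l p > 0, and a nonnegative multiple of p if l p = 0.
  have key : ∀ p ∈ PointedCone.hull ℝ (t : Set V), ∀ b ∈ s₁,
      l p • b - l b • p ∈ PointedCone.hull ℝ (t : Set V) := by
    intro p hp b hb
    have hb' : b ∈ s ∧ l b < 0 := by simpa [hs₁] using hb
    induction hp using Submodule.span_induction with
    | zero => simp
    | add x y hx hy ihx ihy =>
      have := add_mem ihx ihy
      convert this using 1
      rw [map_add]; module
    | smul c x hx ih =>
      have := Submodule.smul_mem _ c ih
      convert this using 1
      obtain ⟨c, hc⟩ := c
      change l (c • x) • b - l b • (c • x) = c • (l x • b - l b • x)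
      rw [map_smul, smul_eq_mul]; module
    | mem x hx =>
      have hx' : x ∈ t := hx
      rw [ht, Finset.mem_union] at hx'
      have hneg : ∀ y ∈ t, (-l b) • y ∈ PointedCone.hull ℝ (t : Set V) := fun y hy =>
        PointedCone.smul_mem _ (by linarith [hb'.2]) (Submodule.subset_span hy)
      rcases hx' with h | h
      · rcases (Finset.mem_filter.1 h).2.eq_or_lt with h0 | h0
        · have := hneg x hx
          rw [← h0]; simpa using this
        · refine Submodule.subset_span ?_
          refine Finset.mem_coe.2 (Finset.mem_union_right _ (Finset.mem_image₂_of_mem ?_ hb))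
          exact Finset.mem_filter.2 ⟨(Finset.mem_filter.1 h).1, h0⟩
      · obtain ⟨a, ha, b', hb', rfl⟩ := Finset.mem_image₂.1 h
        have := hneg _ hx
        have h0 : l (l a • b' - l b' • a) = 0 := by
          simp only [map_sub, map_smul, smul_eq_mul]; ring
        rw [h0]; simpa using this
  -- If c > 0 then l p > 0, and p + c b is a nonnegative combination of p and of the point that
  -- `key` provides.
  have step : ∀ p ∈ PointedCone.hull ℝ (t : Set V), ∀ b ∈ s₁, ∀ c : ℝ, 0 ≤ c →
      0 ≤ l (p + c • b) → p + c • b ∈ PointedCone.hull ℝ (t : Set V) := by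
    intro p hp b hb c hc h
    have hb' : b ∈ s ∧ l b < 0 := by simpa [hs₁] using hb
    rw [map_add, map_smul, smul_eq_mul] at h
    rcases hc.eq_or_lt with rfl | hc'
    · simpa using hp
    have hlp : 0 < l p := by nlinarith [mul_pos hc' (neg_pos.2 hb'.2)]
    have e : p + c • b = (c / l p) • (l p • b - l b • p) + ((l p + c * l b) / l p) • p := by
      have : l p ≠ 0 := hlp.ne'
      match_scalars <;> field_simp
      ring
    rw [e]
    exact add_mem (PointedCone.smul_mem _ (by positivity) (key p hp b hb))
      (PointedCone.smul_mem _ (div_nonneg h hlp.le) hp)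
  have steps : ∀ (c : V → ℝ), (∀ a, 0 ≤ c a) → ∀ u ⊆ s₁, ∀ p ∈ PointedCone.hull ℝ (t : Set V),
      0 ≤ l (p + ∑ b ∈ u, c b • b) → p + ∑ b ∈ u, c b • b ∈ PointedCone.hull ℝ (t : Set V) := by
    intro c hc u
    induction u using Finset.induction_on with
    | empty => intro _ p hp _; simpa using hp
    | insert b u hbu ih =>
      intro hu p hp h
      rw [Finset.sum_insert hbu, ← add_assoc] at h ⊢
      have hu' : u ⊆ s₁ := fun x hx => hu (Finset.mem_insert_of_mem hx)
      refine ih hu' _ (step p hp b (hu (Finset.mem_insert_self _ _)) _ (hc b) ?_) h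
      rw [map_add] at h
      -- The negative generators are added one at a time. Those still to come only lower l, so a
      -- total with l ≥ 0 forces l ≥ 0 at every intermediate stage.
      have : l (∑ b ∈ u, c b • b) ≤ 0 := by
        rw [map_sum]
        refine Finset.sum_nonpos fun x hx => ?_
        have hx' : l x < 0 := by simpa using (Finset.mem_filter.1 (hu' hx)).2
        rw [map_smul, smul_eq_mul]
        exact mul_nonpos_of_nonneg_of_nonpos (hc x) hx'.le
      linarith
  refine ⟨t, ?_, le_antisymm ?_ (le_inf ?_ ?_)⟩
  · intro x hx
    rcases Finset.mem_union.1 (Finset.mem_coe.1 hx) with h | h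
    · exact hsA (Finset.mem_filter.1 h).1
    · obtain ⟨a, ha, b, hb, rfl⟩ := Finset.mem_image₂.1 h
      rw [Finset.mem_filter] at ha hb
      exact hl a (hsA ha.1) b (hsA hb.1) ha.2 (not_le.1 hb.2)
  · rintro x ⟨hx, hlx⟩
    obtain ⟨c, hc, rfl⟩ := exists_coeff_of_mem_hull hx
    have hlx' : 0 ≤ l (∑ a ∈ s, c a • a) := hlx
    rw [← Finset.sum_filter_add_sum_filter_not s (fun a => 0 ≤ l a)] at hlx' ⊢
    refine steps c hc s₁ subset_rfl _ (sum_smul_mem hc fun a ha => ?_) hlx'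
    exact Submodule.subset_span (Finset.mem_coe.2 (Finset.mem_union_left _ ha))
  · refine Submodule.span_le.2 fun x hx => ?_
    rcases Finset.mem_union.1 (Finset.mem_coe.1 hx) with h | h
    · exact Submodule.subset_span (Finset.mem_filter.1 h).1
    · obtain ⟨a, ha, b, hb, rfl⟩ := Finset.mem_image₂.1 h
      rw [Finset.mem_filter] at ha hb
      rw [sub_eq_add_neg, ← neg_smul]
      exact add_mem (PointedCone.smul_mem _ ha.2.le (Submodule.subset_span hb.1))
        (PointedCone.smul_mem _ (by linarith [not_le.1 hb.2]) (Submodule.subset_span ha.1))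
  · refine Submodule.span_le.2 fun x hx => ?_
    rcases Finset.mem_union.1 (Finset.mem_coe.1 hx) with h | h
    · exact (Finset.mem_filter.1 h).2
    · obtain ⟨a, ha, b, hb, rfl⟩ := Finset.mem_image₂.1 h
      have h0 : l (l a • b - l b • a) = 0 := by
        simp only [map_sub, map_smul, smul_eq_mul]; ring
      exact h0.ge

lemma GeneratedIn.mono {A B : Set V} (h : A ⊆ B) {σ : PointedCone ℝ V} (hσ : GeneratedIn A σ) :
    GeneratedIn B σ :=
  let ⟨s, hs, e⟩ := hσ
  ⟨s, hs.trans h, e⟩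

/-- A face of a finitely generated cone is generated by some of the generators. -/
lemma GeneratedIn.face {A : Set V} {σ F : PointedCone ℝ V} (hσ : GeneratedIn A σ)
    (hF : F.IsFaceOf σ) : GeneratedIn A F := by
  classical
  obtain ⟨s, hsA, rfl⟩ := hσ
  refine ⟨s.filter (· ∈ F), fun x hx => hsA (Finset.mem_filter.1 hx).1, le_antisymm ?_ ?_⟩
  · intro x hx
    obtain ⟨c, hc, rfl⟩ := exists_coeff_of_mem_hull (hF.le hx)
    refine Submodule.sum_mem _ fun a ha => ?_
    rcases (hc a).eq_or_lt with h | h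
    · rw [← h]; simp
    refine PointedCone.smul_mem _ h.le (Submodule.subset_span (Finset.mem_filter.2 ⟨ha, ?_⟩))
    rw [← Finset.add_sum_erase s _ ha] at hx
    refine hF.mem_of_smul_add_mem (Submodule.subset_span ha) ?_ h hx
    exact sum_smul_mem hc fun b hb => Submodule.subset_span (Finset.mem_of_mem_erase hb)
  · exact Submodule.span_le.2 fun x hx => (Finset.mem_filter.1 hx).2

/-- The smallest face of `C` containing the point `x` of `C`. -/
def minFace (C : PointedCone ℝ V) (x : V) : PointedCone ℝ V where
  carrier := {y | y ∈ C ∧ ∃ c : ℝ, 0 ≤ c ∧ c • x - y ∈ C}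
  zero_mem' := ⟨C.zero_mem, 0, le_rfl, by simp⟩
  add_mem' := by
    rintro y z ⟨hy, c, hc, hyc⟩ ⟨hz, d, hd, hzd⟩
    refine ⟨add_mem hy hz, c + d, add_nonneg hc hd, ?_⟩
    convert add_mem hyc hzd using 1
    module
  smul_mem' := by
    rintro ⟨a, ha⟩ y ⟨hy, c, hc, hyc⟩
    refine ⟨C.smul_mem (r := a) ha hy, a * c, mul_nonneg ha hc, ?_⟩
    convert PointedCone.smul_mem C ha hyc using 1
    change (a * c) • x - a • y = _
    module

lemma minFace_isFaceOf (C : PointedCone ℝ V) (x : V) : (minFace C x).IsFaceOf C where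
  le _ h := h.1
  mem_of_smul_add_mem := by
    rintro y z a hy hz ha ⟨-, c, hc, h⟩
    refine ⟨hy, a⁻¹ * c, by positivity, ?_⟩
    convert PointedCone.smul_mem C (inv_nonneg.2 ha.le) (add_mem h hz) using 1
    match_scalars <;> field_simp
    ring

/-- A finitely generated cone contains a point lying on no proper face. -/
lemma GeneratedIn.exists_interior {A : Set V} {C : PointedCone ℝ V} (hC : GeneratedIn A C) :
    ∃ x ∈ C, minFace C x = C := by
  classical
  obtain ⟨s, -, rfl⟩ := hC
  have hs : ∀ t ⊆ s, ∑ a ∈ t, a ∈ PointedCone.hull ℝ (s : Set V) := fun t ht =>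
    Submodule.sum_mem _ fun a ha => Submodule.subset_span (ht ha)
  -- The sum of the generators dominates each of them: removing one leaves the sum of the others.
  refine ⟨∑ a ∈ s, a, hs s subset_rfl, le_antisymm (minFace_isFaceOf _ _).le ?_⟩
  refine Submodule.span_le.2 fun a ha => ⟨Submodule.subset_span ha, 1, zero_le_one, ?_⟩
  rw [one_smul, ← Finset.add_sum_erase s _ (Finset.mem_coe.1 ha), add_sub_cancel_left]
  exact hs _ (Finset.erase_subset _ _)

/-- A face of an intersection of two cones is the intersection of faces of the two cones. -/
lemma exists_inf_eq_of_isFaceOf_inf {A : Set V} {C D F : PointedCone ℝ V} (hF : F.IsFaceOf (C ⊓ D))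
    (hg : GeneratedIn A F) : ∃ C' D' : PointedCone ℝ V, C'.IsFaceOf C ∧ D'.IsFaceOf D ∧
      F = C' ⊓ D' := by
  obtain ⟨x, hx, hmin⟩ := hg.exists_interior
  have hxCD := hF.le hx
  -- Here x is interior to F, so F is recovered from the smallest faces of C and of D through x.
  refine ⟨minFace C x, minFace D x, minFace_isFaceOf _ _, minFace_isFaceOf _ _, le_antisymm ?_ ?_⟩
  · intro y hy
    obtain ⟨hyC, hyD⟩ := hF.le hy
    rw [← hmin] at hy
    obtain ⟨-, c, hc, h⟩ := hy
    exact ⟨⟨hyC, c, hc, (hF.le h).1⟩, ⟨hyD, c, hc, (hF.le h).2⟩⟩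
  · rintro y ⟨⟨hyC, c, hc, h⟩, ⟨hyD, d, hd, h'⟩⟩
    -- The multiple c x dominates y in C and d x does so in D; (c + d) x does so in both, because x
    -- lies in both.
    refine hF.mem_of_add_mem_left (y := (c + d) • x - y) ⟨hyC, hyD⟩ ⟨?_, ?_⟩ ?_
    · have e : (c + d) • x - y = c • x - y + d • x := by module
      rw [e]
      exact add_mem h (C.smul_mem hd hxCD.1)
    · have e : (c + d) • x - y = d • x - y + c • x := by module
      rw [e]
      exact add_mem h' (D.smul_mem hc hxCD.2)
    · rw [add_sub_cancel]
      exact F.smul_mem (add_nonneg hc hd) hx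

/-- If the intersection with `D` of a cone is a face containing a point on no proper face,
then the cone lies in `D`. -/
lemma le_of_inf_isFaceOf {C D : PointedCone ℝ V} (h : (C ⊓ D).IsFaceOf C) {x : V} (hx : x ∈ C)
    (hmin : minFace C x = C) (hxD : x ∈ D) : C ≤ D := by
  intro y hy
  have hy' := hy
  rw [← hmin] at hy
  obtain ⟨-, c, hc, h'⟩ := hy
  refine (h.mem_of_add_mem_left hy' h' ?_).2
  rw [add_sub_cancel]
  exact (C ⊓ D).smul_mem hc ⟨hx, hxD⟩

/-! ### Prefans and their refinement by hyperplanes -/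

/-- A finite set of cones, generated by finite subsets of `A`, that satisfies the axioms of a fan
except for strict convexity. -/
structure IsPrefan (A : Set V) (T : Set (PointedCone ℝ V)) : Prop where
  finite : T.Finite
  gen : ∀ σ ∈ T, GeneratedIn A σ
  face_mem : ∀ σ ∈ T, ∀ τ : PointedCone ℝ V, τ.IsFaceOf σ → τ ∈ T
  inf_isFaceOf : ∀ σ ∈ T, ∀ τ ∈ T, (σ ⊓ τ).IsFaceOf σ ∧ (σ ⊓ τ).IsFaceOf τ

lemma IsPrefan.mono {A B : Set V} (h : A ⊆ B) {T : Set (PointedCone ℝ V)} (hT : IsPrefan A T) :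
    IsPrefan B T :=
  ⟨hT.finite, fun σ hσ => (hT.gen σ hσ).mono h, hT.face_mem, hT.inf_isFaceOf⟩

/-- The two closed half-spaces and the hyperplane defined by a linear functional. -/
def sides (l : V →ₗ[ℝ] ℝ) : Set (PointedCone ℝ V) :=
  {halfSpace l, halfSpace (-l), halfSpace l ⊓ halfSpace (-l)}

lemma mem_hyperplane {l : V →ₗ[ℝ] ℝ} {x : V} :
    x ∈ halfSpace l ⊓ halfSpace (-l) ↔ l x = 0 := by
  simp only [Submodule.mem_inf, mem_halfSpace, LinearMap.neg_apply]
  constructor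
  · rintro ⟨h, h'⟩; linarith
  · intro h; simp [h]

lemma hyperplane_isFaceOf (l : V →ₗ[ℝ] ℝ) :
    (halfSpace l ⊓ halfSpace (-l)).IsFaceOf (halfSpace l) where
  le := inf_le_left
  mem_of_smul_add_mem := by
    intro x y a hx hy ha h
    rw [mem_hyperplane, map_add, map_smul, smul_eq_mul] at h
    rw [mem_halfSpace] at hx hy
    rw [mem_hyperplane]
    nlinarith [mul_nonneg ha.le hx]

/-- A linear subspace inside a cone lies in every face, since x + (-x) = 0 belongs to the face. -/
lemma hyperplane_le_of_isFaceOf {l : V →ₗ[ℝ] ℝ} {F C : PointedCone ℝ V} (hF : F.IsFaceOf C)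
    (hC : halfSpace l ⊓ halfSpace (-l) ≤ C) : halfSpace l ⊓ halfSpace (-l) ≤ F := by
  intro x hx
  have hx' : -x ∈ halfSpace l ⊓ halfSpace (-l) := by
    rw [mem_hyperplane] at hx ⊢; simp [hx]
  exact hF.mem_of_add_mem_left (hC hx) (hC hx') (by simp)

/-- Every face contains the bounding hyperplane, and the hyperplane together with a single point
where l > 0 generates the half-space. -/
lemma eq_of_isFaceOf_halfSpace {l : V →ₗ[ℝ] ℝ} {F : PointedCone ℝ V}
    (hF : F.IsFaceOf (halfSpace l)) : F = halfSpace l ∨ F = halfSpace l ⊓ halfSpace (-l) := by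
  have hle := hyperplane_le_of_isFaceOf hF inf_le_left
  by_cases h : ∃ x ∈ F, 0 < l x
  · left
    obtain ⟨x, hx, hlx⟩ := h
    refine le_antisymm hF.le fun y hy => ?_
    have : y - (l y / l x) • x ∈ F := hle (by
      rw [mem_hyperplane]
      simp only [map_sub, map_smul, smul_eq_mul]; field_simp; ring)
    rw [← sub_add_cancel y ((l y / l x) • x)]
    exact add_mem this (F.smul_mem (div_nonneg hy hlx.le) hx)
  · right
    push Not at h
    exact le_antisymm (fun x hx => mem_hyperplane.2 (le_antisymm (h x hx) (hF.le hx))) hle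

lemma sides_face_mem {l : V →ₗ[ℝ] ℝ} {C F : PointedCone ℝ V} (hC : C ∈ sides l)
    (hF : F.IsFaceOf C) : F ∈ sides l := by
  rcases hC with rfl | rfl | rfl
  · rcases eq_of_isFaceOf_halfSpace hF with h | h
    · exact Or.inl h
    · exact Or.inr (Or.inr h)
  · rcases eq_of_isFaceOf_halfSpace hF with h | h
    · exact Or.inr (Or.inl h)
    · rw [neg_neg, inf_comm] at h
      exact Or.inr (Or.inr h)
  · exact Or.inr (Or.inr (le_antisymm hF.le (hyperplane_le_of_isFaceOf hF le_rfl)))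

lemma sides_inf_isFaceOf {l : V →ₗ[ℝ] ℝ} {C D : PointedCone ℝ V} (hC : C ∈ sides l)
    (hD : D ∈ sides l) : (C ⊓ D).IsFaceOf C := by
  have h := hyperplane_isFaceOf l
  have h' := hyperplane_isFaceOf (-l)
  rw [neg_neg, inf_comm] at h'
  rcases hC with rfl | rfl | rfl <;> rcases hD with rfl | rfl | rfl <;>
    simp [inf_comm (halfSpace (-l)) (halfSpace l), h, h']

lemma GeneratedIn.inf_side {A : Set V} {σ : PointedCone ℝ V} (hσ : GeneratedIn A σ)
    {l : V →ₗ[ℝ] ℝ} (hl : EliminationClosed A l) (hl' : EliminationClosed A (-l))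
    {C : PointedCone ℝ V} (hC : C ∈ sides l) : GeneratedIn A (σ ⊓ C) := by
  rcases hC with rfl | rfl | rfl
  · exact hσ.inf_halfSpace hl
  · exact hσ.inf_halfSpace hl'
  · rw [← inf_assoc]
    exact (hσ.inf_halfSpace hl).inf_halfSpace hl'

/-- Cutting the cones of a prefan along a hyperplane gives a prefan. -/
lemma IsPrefan.cut {A : Set V} {T : Set (PointedCone ℝ V)} (hT : IsPrefan A T)
    {l : V →ₗ[ℝ] ℝ} (hl : EliminationClosed A l) (hl' : EliminationClosed A (-l)) :
    IsPrefan A (Set.image2 (· ⊓ ·) T (sides l)) where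
  finite := hT.finite.image2 _ (by simp [sides])
  gen := by
    rintro _ ⟨σ, hσ, C, hC, rfl⟩
    exact (hT.gen σ hσ).inf_side hl hl' hC
  face_mem := by
    rintro _ ⟨σ, hσ, C, hC, rfl⟩ F hF
    obtain ⟨σ', C', h1, h2, rfl⟩ := exists_inf_eq_of_isFaceOf_inf hF
      (((hT.gen σ hσ).inf_side hl hl' hC).face hF)
    exact ⟨σ', hT.face_mem σ hσ _ h1, C', sides_face_mem hC h2, rfl⟩
  inf_isFaceOf := by
    rintro _ ⟨σ, hσ, C, hC, rfl⟩ _ ⟨τ, hτ, D, hD, rfl⟩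
    have e : σ ⊓ C ⊓ (τ ⊓ D) = σ ⊓ τ ⊓ (C ⊓ D) := inf_inf_inf_comm _ _ _ _
    simp only [e]
    refine ⟨(hT.inf_isFaceOf σ hσ τ hτ).1.inf (sides_inf_isFaceOf hC hD),
      (hT.inf_isFaceOf σ hσ τ hτ).2.inf ?_⟩
    rw [inf_comm]
    exact sides_inf_isFaceOf hD hC

/-- `l` does not take both signs on `σ`. -/
def SignConst (l : V →ₗ[ℝ] ℝ) (σ : PointedCone ℝ V) : Prop :=
  (∀ x ∈ σ, 0 ≤ l x) ∨ ∀ x ∈ σ, l x ≤ 0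

lemma SignConst.mono {l : V →ₗ[ℝ] ℝ} {σ τ : PointedCone ℝ V} (h : SignConst l σ) (hle : τ ≤ σ) :
    SignConst l τ :=
  h.imp (fun h x hx => h x (hle hx)) (fun h x hx => h x (hle hx))

/-- Every prefan can be refined so that finitely many given linear functionals have constant sign
on each cone. -/
lemma IsPrefan.exists_refine {T : Set (PointedCone ℝ V)} (hT : IsPrefan Set.univ T)
    {H : Set (V →ₗ[ℝ] ℝ)} (hH : H.Finite) :
    ∃ T' : Set (PointedCone ℝ V), IsPrefan Set.univ T' ∧
      (⋃ σ ∈ T', (σ : Set V)) = (⋃ σ ∈ T, (σ : Set V)) ∧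
      (∀ σ' ∈ T', ∃ σ ∈ T, σ' ≤ σ) ∧
      (∀ l ∈ H, ∀ σ ∈ T', SignConst l σ) ∧
      ∀ A : Set V, (∀ l ∈ H, EliminationClosed A l ∧ EliminationClosed A (-l)) →
        IsPrefan A T → IsPrefan A T' := by
  induction H, hH using Set.Finite.induction_on with
  | empty => exact ⟨T, hT, rfl, fun σ hσ => ⟨σ, hσ, le_rfl⟩, by simp, fun A _ h => h⟩
  | @insert l H hl hH ih =>
    obtain ⟨T', h1, h2, h3, h4, h5⟩ := ih
    refine ⟨Set.image2 (· ⊓ ·) T' (sides l), h1.cut (fun _ _ _ _ _ _ => trivial)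
      (fun _ _ _ _ _ _ => trivial), ?_, ?_, ?_, ?_⟩
    · rw [← h2]
      ext x
      simp only [Set.mem_iUnion, SetLike.mem_coe, exists_prop]
      constructor
      · rintro ⟨_, ⟨σ, hσ, C, hC, rfl⟩, hx⟩
        exact ⟨σ, hσ, hx.1⟩
      · rintro ⟨σ, hσ, hx⟩
        rcases le_total 0 (l x) with h | h
        · exact ⟨_, ⟨σ, hσ, _, Or.inl rfl, rfl⟩, hx, h⟩
        · exact ⟨_, ⟨σ, hσ, _, Or.inr (Or.inl rfl), rfl⟩, hx, by simpa using h⟩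
    · rintro _ ⟨σ, hσ, C, hC, rfl⟩
      obtain ⟨τ, hτ, h⟩ := h3 σ hσ
      exact ⟨τ, hτ, inf_le_left.trans h⟩
    · rintro m (rfl | hm) _ ⟨σ, hσ, C, hC, rfl⟩
      · rcases hC with rfl | rfl | rfl
        · exact Or.inl fun x hx => hx.2
        · exact Or.inr fun x hx => by simpa using hx.2
        · exact Or.inl fun x hx => hx.2.1
      · exact (h4 m hm σ hσ).mono inf_le_left
    · intro A hA hTA
      exact (h5 A (fun m hm => hA m (Or.inr hm)) hTA).cut (hA l (Or.inl rfl)).1 (hA l (Or.inl rfl)).2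

lemma Fan.isPrefan (S : Fan V) : IsPrefan Set.univ S.cones :=
  ⟨S.finite, fun σ hσ => let ⟨s, hs⟩ := S.fg σ hσ; ⟨s, Set.subset_univ _, hs⟩, S.face_mem,
    S.inf_isFaceOf⟩

/-- A prefan of strictly convex cones is a fan. -/
def IsPrefan.toFan {T : Set (PointedCone ℝ V)} (hT : IsPrefan Set.univ T)
    (hs : ∀ σ ∈ T, ∀ x ∈ σ, -x ∈ σ → x = 0) : Fan V where
  cones := T
  finite := hT.finite
  fg σ hσ := let ⟨s, _, hs⟩ := hT.gen σ hσ; ⟨s, hs⟩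
  salient := hs
  face_mem := hT.face_mem
  inf_isFaceOf := hT.inf_isFaceOf

end Cones

/-! ### Complete fans and piecewise linear functions -/

section PiecewiseLinear

open Filter Topology

variable {V : Type*} [AddCommGroup V] [Module ℝ V]

lemma mem_hull_insert {s : Set V} {a x : V} :
    x ∈ PointedCone.hull ℝ (insert a s) ↔
      ∃ t : ℝ, 0 ≤ t ∧ x - t • a ∈ PointedCone.hull ℝ s := by
  rw [PointedCone.hull, Submodule.mem_span_insert]
  constructor
  · rintro ⟨⟨t, ht⟩, z, hz, rfl⟩
    refine ⟨t, ht, ?_⟩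
    change t • a + z - t • a ∈ _
    simpa using hz
  · rintro ⟨t, ht, h⟩
    refine ⟨⟨t, ht⟩, _, h, ?_⟩
    change x = t • a + (x - t • a)
    simp

/-- A finitely generated cone is an intersection of finitely many half-spaces. -/
lemma exists_halfSpaces [FiniteDimensional ℝ V] (s : Finset V) :
    ∃ H : Finset (V →ₗ[ℝ] ℝ), ∀ x, x ∈ PointedCone.hull ℝ (s : Set V) ↔ ∀ l ∈ H, 0 ≤ l x := by
  classical
  induction s using Finset.induction_on with
  | empty =>
    let b := Module.finBasis ℝ V
    refine ⟨Finset.univ.image b.coord ∪ Finset.univ.image fun i => -b.coord i, fun x => ?_⟩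
    have : x = 0 ↔ ∀ i, b.coord i x = 0 := by
      simp [← b.forall_coord_eq_zero_iff]
    simp only [Finset.coe_empty, Submodule.span_empty, Submodule.mem_bot, this, PointedCone.hull]
    constructor
    · intro h l hl
      rcases Finset.mem_union.1 hl with hl | hl <;> obtain ⟨i, -, rfl⟩ := Finset.mem_image.1 hl
      · exact (h i).ge
      · rw [LinearMap.neg_apply, h i, neg_zero]
    · intro h i
      have h1 := h (b.coord i) (by simp)
      have h2 := h (-b.coord i) (by simp)
      rw [LinearMap.neg_apply] at h2
      linarith
  | insert a s _ ih =>
    obtain ⟨H, hH⟩ := ih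
    -- Fourier–Motzkin elimination: these are the consequences, free of t, of the inequalities t ≥ 0
    -- and l x - t l a ≥ 0 for l in H.
    refine ⟨H.filter (fun l => 0 ≤ l a) ∪ Finset.image₂ (fun l m => l a • m - m a • l)
      (H.filter fun l => 0 ≤ l a) (H.filter fun l => l a < 0), fun x => ?_⟩
    rw [Finset.coe_insert, mem_hull_insert]
    simp only [hH, map_sub, map_smul, smul_eq_mul]
    constructor
    · rintro ⟨t, ht, h⟩ l hl
      rcases Finset.mem_union.1 hl with hl | hl
      · rw [Finset.mem_filter] at hl
        nlinarith [h l hl.1, mul_nonneg ht hl.2]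
      · obtain ⟨l, hl', m, hm, rfl⟩ := Finset.mem_image₂.1 hl
        rw [Finset.mem_filter] at hl' hm
        simp only [LinearMap.sub_apply, LinearMap.smul_apply, smul_eq_mul]
        nlinarith [mul_nonneg hl'.2 (h m hm.1), mul_nonneg (neg_nonneg.2 hm.2.le) (h l hl'.1)]
    · intro h
      have h1 : ∀ l ∈ H, 0 ≤ l a → 0 ≤ l x := fun l hl hla =>
        h l (Finset.mem_union_left _ (Finset.mem_filter.2 ⟨hl, hla⟩))
      have h2 : ∀ l ∈ H, 0 ≤ l a → ∀ m ∈ H, m a < 0 → 0 ≤ l a * m x - m a * l x := by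
        intro l hl hla m hm hma
        have := h (l a • m - m a • l) (Finset.mem_union_right _ (Finset.mem_image₂_of_mem
          (Finset.mem_filter.2 ⟨hl, hla⟩) (Finset.mem_filter.2 ⟨hm, hma⟩)))
        simpa using this
      -- Q collects the lower bounds on t, namely 0 and l x / l a for l a < 0. The largest one is
      -- taken as t, and the eliminated inequalities say that it respects every upper bound.
      let Q := insert (0 : ℝ) ((H.filter fun l => l a < 0).image fun l => l x / l a)
      have hQ : Q.Nonempty := Finset.insert_nonempty _ _
      refine ⟨Q.max' hQ, Finset.le_max' _ _ (Finset.mem_insert_self _ _), fun l hl => ?_⟩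
      rcases le_or_gt 0 (l a) with hla | hla
      · rcases Finset.mem_insert.1 (Q.max'_mem hQ) with h0 | h0
        · rw [h0]; simpa using h1 l hl hla
        · obtain ⟨m, hm, e⟩ := Finset.mem_image.1 h0
          rw [Finset.mem_filter] at hm
          rw [← e]
          have := h2 l hl hla m hm.1 hm.2
          have e2 : l x - m x / m a * l a = (l a * m x - m a * l x) / (-m a) := by
            have := hm.2.ne
            field_simp
            ring
          rw [e2]
          exact div_nonneg this (by linarith [hm.2])
      · have : l x / l a ≤ Q.max' hQ := Finset.le_max' _ _ (Finset.mem_insert_of_mem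
          (Finset.mem_image_of_mem (fun l => l x / l a) (Finset.mem_filter.2 ⟨hl, hla⟩)))
        rw [div_le_iff_of_neg hla] at this
        linarith

lemma Fan.exists_halfSpaces [FiniteDimensional ℝ V] (S : Fan V) {σ : PointedCone ℝ V}
    (hσ : σ ∈ S.cones) : ∃ H : Finset (V →ₗ[ℝ] ℝ), ∀ x, x ∈ σ ↔ ∀ l ∈ H, 0 ≤ l x := by
  obtain ⟨s, rfl⟩ := S.fg σ hσ
  exact ToricPL.exists_halfSpaces s

lemma Fan.IsComplete.exists_mem {S : Fan V} (hS : S.IsComplete) (x : V) :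
    ∃ σ ∈ S.cones, x ∈ σ := by
  have : x ∈ S.support := hS ▸ Set.mem_univ x
  simpa [Fan.support] using this

/-- In a complete fan the full-dimensional cones cover the space. -/
lemma Fan.IsComplete.exists_mem_full [FiniteDimensional ℝ V] {S : Fan V} (hS : S.IsComplete)
    (x : V) : ∃ σ ∈ S.cones, x ∈ σ ∧ Submodule.span ℝ (σ : Set V) = ⊤ := by
  classical
  let W : Set (Submodule ℝ V) :=
    {W | ∃ σ ∈ S.cones, Submodule.span ℝ (σ : Set V) = W ∧ W ≠ ⊤}
  have hW : W.Finite := (S.finite.image fun σ : PointedCone ℝ V =>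
    Submodule.span ℝ (σ : Set V)).subset (by rintro _ ⟨σ, hσ, rfl, -⟩; exact ⟨σ, hσ, rfl⟩)
  -- A real vector space is not a finite union of proper subspaces, so some direction z avoids the
  -- span of every cone that is not full-dimensional.
  obtain ⟨z, hz⟩ : ∃ z, ∀ w ∈ W, z ∉ w := by
    have := Subspace.biUnion_ne_univ_of_top_notMem (s := hW.toFinset)
      (by simp [W])
    obtain ⟨z, hz⟩ := (Set.ne_univ_iff_exists_notMem _).1 this
    exact ⟨z, fun w hw h => hz (by simpa using ⟨w, hw, h⟩)⟩
  -- There are finitely many cones, so one of them contains x + t z for arbitrarily small t > 0. It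
  -- contains x since it is closed, and its span contains z because it holds two such points with
  -- different t.
  obtain ⟨σ, hσ, hfr⟩ : ∃ σ ∈ S.cones, ∃ᶠ t : ℝ in 𝓝[>] 0, x + t • z ∈ σ := by
    by_contra! h
    have h' : ∀ᶠ t : ℝ in 𝓝[>] 0, ∀ σ ∈ S.cones, x + t • z ∉ σ :=
      (Filter.eventually_all_finite S.finite).2 fun σ hσ => by
        simpa [Filter.not_frequently] using h σ hσ
    obtain ⟨t, ht⟩ := h'.exists
    obtain ⟨σ, hσ, hx⟩ := hS.exists_mem (x + t • z)
    exact ht σ hσ hx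
  refine ⟨σ, hσ, ?_, ?_⟩
  · obtain ⟨H, hH⟩ := S.exists_halfSpaces hσ
    refine (hH x).2 fun l hl => ?_
    by_contra! hlx
    have hc : Tendsto (fun t : ℝ => l (x + t • z)) (𝓝[>] 0) (𝓝 (l x)) := by
      have : Continuous fun t : ℝ => l x + t * l z := by fun_prop
      simpa using (this.tendsto 0).mono_left nhdsWithin_le_nhds
    obtain ⟨t, h1, h2⟩ := (hfr.and_eventually (hc.eventually_lt_const hlx)).exists
    exact absurd ((hH _).1 h1 l hl) (not_le.2 h2)
  · by_contra hne
    have hzσ := hz _ ⟨σ, hσ, rfl, hne⟩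
    obtain ⟨t, ht, ht0⟩ := (hfr.and_eventually self_mem_nhdsWithin).exists
    obtain ⟨t', ht', -, htt⟩ := (hfr.and_eventually
      (Ioo_mem_nhdsGT (Set.mem_Ioi.1 ht0))).exists
    refine hzσ ?_
    have h := Submodule.sub_mem _ (Submodule.subset_span (R := ℝ) (s := (σ : Set V)) ht)
      (Submodule.subset_span (R := ℝ) (s := (σ : Set V)) ht')
    have e : x + t • z - (x + t' • z) = (t - t') • z := by module
    rw [e] at h
    exact (Submodule.smul_mem_iff _ (sub_ne_zero.2 htt.ne')).1 h

/-- A function that is linear on the cones of a complete fan is continuous on lines. -/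
lemma continuous_line_of_mem_PLOn [FiniteDimensional ℝ V] {S : Fan V} (hS : S.IsComplete)
    {h : V → ℝ} (hh : h ∈ PLOn S) (x z : V) : Continuous fun t : ℝ => h (x + t • z) := by
  have : Finite S.cones := S.finite
  -- The line is covered by finitely many closed sets, the traces of the cones, on each of which the
  -- function is affine in t.
  refine (locallyFinite_of_finite fun σ : S.cones => {t : ℝ | x + t • z ∈ σ.1}).continuous
    ?_ ?_ ?_
  · refine Set.eq_univ_of_forall fun t => ?_
    obtain ⟨σ, hσ, hx⟩ := hS.exists_mem (x + t • z)
    exact Set.mem_iUnion.2 ⟨⟨σ, hσ⟩, hx⟩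
  · rintro ⟨σ, hσ⟩
    obtain ⟨H, hH⟩ := S.exists_halfSpaces hσ
    simp only [hH, map_add, map_smul, smul_eq_mul, Set.ofPred_forall]
    exact isClosed_biInter fun l _ => isClosed_le continuous_const (by fun_prop)
  · rintro ⟨σ, hσ⟩
    obtain ⟨u, hu⟩ := hh σ hσ
    have : Continuous fun t : ℝ => u x + t * u z := by fun_prop
    refine this.continuousOn.congr fun t ht => ?_
    rw [hu _ ht]; simp

/-- On a cone on which the differences of finitely many linear functionals have constant sign,
a function that takes at each point one of their values and is continuous on lines agrees with
one of them. -/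
lemma exists_eqOn_of_signConst {C : PointedCone ℝ V} {A : Set V} (hC : GeneratedIn A C)
    {U : Set (V →ₗ[ℝ] ℝ)} (hU : U.Finite)
    (hsign : ∀ u ∈ U, ∀ u' ∈ U, SignConst (u - u') C) {h : V → ℝ}
    (hval : ∀ x, ∃ u ∈ U, h x = u x) (hcont : ∀ x z, Continuous fun t : ℝ => h (x + t • z)) :
    ∃ u ∈ U, ∀ x ∈ C, h x = u x := by
  obtain ⟨x₀, hx₀, hmin⟩ := hC.exists_interior
  obtain ⟨u, hu, hux⟩ := hval x₀
  refine ⟨u, hu, fun y hy => ?_⟩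
  -- A lower bound c for the nonzero gaps at the interior point between u and the other functionals.
  obtain ⟨c, hc, hcU⟩ : ∃ c > 0, ∀ u' ∈ U, u' x₀ = u x₀ ∨ c ≤ |u' x₀ - u x₀| := by
    clear hval hsign hu
    induction U, hU using Set.Finite.induction_on with
    | empty => exact ⟨1, one_pos, by simp⟩
    | @insert v U _ _ ih =>
      obtain ⟨c, hc, h⟩ := ih
      by_cases hv : v x₀ = u x₀
      · refine ⟨c, hc, ?_⟩
        rintro u' (rfl | hu')
        · exact Or.inl hv
        · exact h u' hu'
      · refine ⟨min c |v x₀ - u x₀|, lt_min hc (abs_pos.2 (sub_ne_zero.2 hv)), ?_⟩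
        rintro u' (rfl | hu')
        · exact Or.inr (min_le_right _ _)
        · exact (h u' hu').imp_right (min_le_left _ _).trans
  -- On the segment from y (t = 0) to x₀ (t = 1) a difference u' - u has constant sign. If it
  -- vanishes at the interior point x₀ it vanishes on all of C; otherwise its endpoint values add
  -- without cancellation and its size is at least c t.
  have hgap : ∀ u' ∈ U, ∀ t : ℝ, 0 < t → t ≤ 1 → u' (y + t • (x₀ - y)) = u (y + t • (x₀ - y)) ∨
      c * t ≤ |u' (y + t • (x₀ - y)) - u (y + t • (x₀ - y))| := by
    intro u' hu' t ht ht1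
    have hzero : ∀ l : V →ₗ[ℝ] ℝ, (∀ x ∈ C, 0 ≤ l x) → l x₀ = 0 → l y = 0 := by
      intro l hl hl0
      have hy' := hy
      rw [← hmin] at hy'
      obtain ⟨-, d, hd, h⟩ := hy'
      have := hl _ h
      rw [map_sub, map_smul, hl0, smul_zero] at this
      linarith [hl y hy]
    have e : u' (y + t • (x₀ - y)) - u (y + t • (x₀ - y)) =
        (1 - t) * (u' y - u y) + t * (u' x₀ - u x₀) := by
      simp only [map_add, map_smul, map_sub, smul_eq_mul]; ring
    rw [← sub_eq_zero, e]
    rcases hcU u' hu' with h0 | h0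
    · left
      have : u' y - u y = 0 := by
        rcases hsign u' hu' u hu with hs | hs
        · exact hzero (u' - u) hs (sub_eq_zero.2 h0)
        · have := hzero (u - u') (fun x hx => by
            have := hs x hx
            simp only [LinearMap.sub_apply] at this ⊢
            linarith) (sub_eq_zero.2 h0.symm)
          rw [LinearMap.sub_apply] at this
          linarith
      rw [this, h0]; ring
    · right
      rcases hsign u' hu' u hu with hs | hs
      · have h1 := hs _ hx₀
        have h2 := hs _ hy
        rw [LinearMap.sub_apply] at h1 h2
        rw [abs_of_nonneg h1] at h0
        refine le_trans ?_ (le_abs_self _)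
        nlinarith [mul_nonneg (sub_nonneg.2 ht1) h2]
      · have h1 := hs _ hx₀
        have h2 := hs _ hy
        rw [LinearMap.sub_apply] at h1 h2
        rw [abs_of_nonpos h1] at h0
        refine le_trans ?_ (neg_le_abs _)
        nlinarith [mul_nonneg (sub_nonneg.2 ht1) (neg_nonneg.2 h2)]
  by_contra hne
  have hcu : Continuous fun t : ℝ => u (y + t • (x₀ - y)) := by
    simp only [map_add, map_smul, smul_eq_mul]; fun_prop
  -- By `hgap`, for 0 < t ≤ 1 the distance |h - u| is either 0 or at least c t. If it were positive
  -- at y, it would cross the line c t / 2 at some t > 0, since it is 0 at x₀; this is impossible.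
  have hφ : ContinuousOn (fun t : ℝ =>
      |h (y + t • (x₀ - y)) - u (y + t • (x₀ - y))| - c / 2 * t) (Set.Icc 0 1) :=
    ((((hcont y (x₀ - y)).sub hcu).abs).sub (by fun_prop)).continuousOn
  have hpos : 0 < |h y - u y| := abs_pos.2 (sub_ne_zero.2 hne)
  obtain ⟨t, ht, ht0⟩ := intermediate_value_Icc' zero_le_one hφ
    (show (0 : ℝ) ∈ _ from ⟨by simp [hux]; positivity, by simp⟩)
  have ht' : |h (y + t • (x₀ - y)) - u (y + t • (x₀ - y))| = c / 2 * t := by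
    simpa [sub_eq_zero] using ht0
  have htpos : 0 < t := by
    rcases ht.1.eq_or_lt with h0 | h0
    · subst h0; simp at ht'; exact absurd (sub_eq_zero.1 ht') hne
    · exact h0
  obtain ⟨u', hu', e⟩ := hval (y + t • (x₀ - y))
  rw [e] at ht'
  rcases hgap u' hu' t htpos ht.2 with h0 | h0
  · rw [h0, sub_self, abs_zero] at ht'
    nlinarith
  · nlinarith

end PiecewiseLinear

/-! ### Lattice points, integrality and rationality -/

section Lattice

open Filter Topology

variable {N : Type*} [AddCommGroup N]

lemma latticePt_add (m n : N) : latticePt (m + n) = latticePt m + latticePt n :=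
  TensorProduct.tmul_add _ _ _

lemma latticePt_sub (m n : N) : latticePt (m - n) = latticePt m - latticePt n :=
  TensorProduct.tmul_sub _ _ _

lemma latticePt_zsmul (c : ℤ) (n : N) : latticePt (c • n) = (c : ℝ) • latticePt n := by
  rw [latticePt, latticePt, TensorProduct.tmul_smul, Int.cast_smul_eq_zsmul]

lemma latticePt_neg (n : N) : latticePt (-n) = -latticePt n :=
  TensorProduct.tmul_neg _ _

/-- The coefficients l a and l b are integers at lattice points. This is what keeps cones rational
when they are cut along an integral hyperplane. -/
lemma eliminationClosed_of_integral {l : NR N →ₗ[ℝ] ℝ} (hl : ⇑l ∈ integralOnLattice N) :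
    EliminationClosed (Set.range (latticePt (N := N))) l := by
  rintro _ ⟨a, rfl⟩ _ ⟨b, rfl⟩ - -
  obtain ⟨m, hm⟩ := hl a
  obtain ⟨m', hm'⟩ := hl b
  exact ⟨m • b - m' • a, by rw [hm, hm', latticePt_sub, latticePt_zsmul, latticePt_zsmul]⟩

lemma neg_mem_integralOnLattice {l : NR N →ₗ[ℝ] ℝ} (hl : ⇑l ∈ integralOnLattice N) :
    ⇑(-l) ∈ integralOnLattice N := fun n =>
  let ⟨m, hm⟩ := hl n
  ⟨-m, by simp [hm]⟩

lemma sub_mem_integralOnLattice {l l' : NR N →ₗ[ℝ] ℝ} (hl : ⇑l ∈ integralOnLattice N)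
    (hl' : ⇑l' ∈ integralOnLattice N) : ⇑(l - l') ∈ integralOnLattice N := fun n =>
  let ⟨m, hm⟩ := hl n
  let ⟨m', hm'⟩ := hl' n
  ⟨m - m', by simp [hm, hm']⟩

lemma generatedIn_range_latticePt_iff {σ : PointedCone ℝ (NR N)} :
    GeneratedIn (Set.range (latticePt (N := N))) σ ↔
      ∃ s : Finset N, σ = PointedCone.hull ℝ (latticePt '' (s : Set N)) := by
  classical
  constructor
  · rintro ⟨s, hs, rfl⟩
    obtain ⟨t, -, rfl⟩ := (Finset.subset_set_image_iff (s := Set.univ) (f := latticePt)).1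
      (by simpa using hs)
    exact ⟨t, by simp⟩
  · rintro ⟨s, rfl⟩
    exact ⟨s.image latticePt, by simp, by simp⟩

/-- The basis of `N_ℝ` given by a basis of `N`. -/
noncomputable def latticeBasis (N : Type*) [AddCommGroup N] [Module.Free ℤ N] :
    Module.Basis (Module.Free.ChooseBasisIndex ℤ N) ℝ (NR N) :=
  (Module.Free.chooseBasis ℤ N).baseChange ℝ

lemma latticeBasis_apply (N : Type*) [AddCommGroup N] [Module.Free ℤ N]
    (i : Module.Free.ChooseBasisIndex ℤ N) :
    latticeBasis N i = latticePt (Module.Free.chooseBasis ℤ N i) := by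
  simp [latticeBasis, latticePt]

variable [Module.Free ℤ N] [Module.Finite ℤ N]

/-- A linear functional that takes integer values on the lattice points of a full-dimensional
cone takes integer values on the lattice. -/
lemma mem_integralOnLattice_of_full {S : Fan (NR N)} {σ : PointedCone ℝ (NR N)}
    (hσ : σ ∈ S.cones) (hfull : Submodule.span ℝ (σ : Set (NR N)) = ⊤) {u : NR N →ₗ[ℝ] ℝ}
    (hu : ∀ n : N, latticePt n ∈ σ → ∃ m : ℤ, u (latticePt n) = m) :
    ⇑u ∈ integralOnLattice N := by
  obtain ⟨H, hH⟩ := S.exists_halfSpaces hσ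
  obtain ⟨p, hp, hmin⟩ := (S.isPrefan.gen σ hσ).exists_interior
  -- A functional that is nonnegative on σ and zero at the interior point p vanishes on σ, hence
  -- everywhere because σ spans.
  have hpos : ∀ l ∈ H, l = 0 ∨ 0 < l p := by
    intro l hl
    rcases ((hH p).1 hp l hl).eq_or_lt with h0 | h0
    · left
      have : Submodule.span ℝ (σ : Set (NR N)) ≤ LinearMap.ker l := by
        refine Submodule.span_le.2 fun y hy => ?_
        have hy' : y ∈ σ := hy
        rw [← hmin] at hy'
        obtain ⟨-, c, hc, h⟩ := hy'
        have := (hH _).1 h l hl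
        rw [map_sub, map_smul, ← h0, smul_zero] at this
        exact le_antisymm (by linarith) ((hH y).1 hy l hl)
      rw [hfull, top_le_iff, LinearMap.ker_eq_top] at this
      exact this
    · exact Or.inr h0
  let b := Module.Free.chooseBasis ℤ N
  -- The multiple k p rounded down to a lattice point. The rounding error is bounded, so l (q k)
  -- stays within a constant of k l p for every functional l.
  let q : ℕ → N := fun k => ∑ i, ⌊(k : ℝ) * (latticeBasis N).repr p i⌋ • b i
  have hq : ∀ l : NR N →ₗ[ℝ] ℝ, ∃ K : ℝ, ∀ k : ℕ, k * l p - K ≤ l (latticePt (q k)) := by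
    intro l
    refine ⟨∑ i, |l (latticeBasis N i)|, fun k => ?_⟩
    have e1 : l (latticePt (q k)) =
        ∑ i, (⌊(k : ℝ) * (latticeBasis N).repr p i⌋ : ℝ) * l (latticeBasis N i) := by
      have : latticePt (q k) =
          ∑ i, (⌊(k : ℝ) * (latticeBasis N).repr p i⌋ : ℝ) • latticeBasis N i := by
        simp only [latticeBasis_apply, ← latticePt_zsmul]
        simp only [q, latticePt, TensorProduct.tmul_sum, b]
      rw [this]; simp
    have e2 : k * l p = ∑ i, (k : ℝ) * (latticeBasis N).repr p i * l (latticeBasis N i) := by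
      conv_lhs => rw [← (latticeBasis N).sum_repr p]
      rw [map_sum, Finset.mul_sum]
      simp only [map_smul, smul_eq_mul, mul_assoc]
    rw [e1, e2, ← Finset.sum_sub_distrib]
    refine Finset.sum_le_sum fun i _ => ?_
    have h1 := Int.floor_le ((k : ℝ) * (latticeBasis N).repr p i)
    have h2 := Int.lt_floor_add_one ((k : ℝ) * (latticeBasis N).repr p i)
    have h3 : |((k : ℝ) * (latticeBasis N).repr p i - ⌊(k : ℝ) * (latticeBasis N).repr p i⌋) *
        l (latticeBasis N i)| ≤ 1 * |l (latticeBasis N i)| := by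
      rw [abs_mul]
      exact mul_le_mul_of_nonneg_right (abs_le.2 ⟨by linarith, by linarith⟩) (abs_nonneg _)
    have := (abs_le.1 h3).2
    linarith
  intro n
  have hev : ∀ᶠ k : ℕ in atTop, ∀ l ∈ H,
      0 ≤ l (latticePt (q k)) ∧ 0 ≤ l (latticePt (q k)) + l (latticePt n) := by
    refine (Filter.eventually_all_finset H).2 fun l hl => ?_
    rcases hpos l hl with rfl | h0
    · simp
    · obtain ⟨K, hK⟩ := hq l
      have ht : Tendsto (fun k : ℕ => (k : ℝ) * l p) atTop atTop :=
        tendsto_natCast_atTop_atTop.atTop_mul_const h0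
      filter_upwards [ht.eventually_ge_atTop (K + |l (latticePt n)|)] with k hk
      have := hK k
      have := neg_abs_le (l (latticePt n))
      have := abs_nonneg (l (latticePt n))
      constructor <;> linarith
  -- For large k both q k and q k + n lie in σ, and u n is the difference of two integers.
  obtain ⟨k, hk⟩ := hev.exists
  obtain ⟨m, hm⟩ := hu (q k) ((hH _).2 fun l hl => (hk l hl).1)
  obtain ⟨m', hm'⟩ := hu (q k + n) ((hH _).2 fun l hl => by
    rw [latticePt_add, map_add]; exact (hk l hl).2)
  refine ⟨m' - m, ?_⟩
  rw [latticePt_add, map_add] at hm'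
  push_cast
  linarith

/-- A piecewise linear function takes at each point the value of one of finitely many linear
functionals, which are integral if the function is, and is continuous on lines. -/
lemma exists_functionals_of_mem_PL {h : NR N → ℝ} (hh : h ∈ PL (NR N)) :
    ∃ U : Set (NR N →ₗ[ℝ] ℝ), U.Finite ∧ (∀ x, ∃ u ∈ U, h x = u x) ∧
      (h ∈ integralOnLattice N → ∀ u ∈ U, ⇑u ∈ integralOnLattice N) ∧
      ∀ x z, Continuous fun t : ℝ => h (x + t • z) := by
  obtain ⟨S, hS, hhS⟩ := hh
  have hhS' := hhS
  choose! u hu using hhS'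
  -- Only full-dimensional cones are kept: they still cover the space, and on a smaller cone the
  -- linear functional is not determined by the function and need not be integral.
  refine ⟨u '' {σ ∈ S.cones | Submodule.span ℝ (σ : Set (NR N)) = ⊤},
    (S.finite.subset (Set.sep_subset _ _)).image _, fun x => ?_, ?_,
    continuous_line_of_mem_PLOn hS hhS⟩
  · obtain ⟨σ, hσ, hx, hfull⟩ := hS.exists_mem_full x
    exact ⟨_, ⟨σ, ⟨hσ, hfull⟩, rfl⟩, hu σ hσ x hx⟩
  · rintro hint _ ⟨σ, ⟨hσ, hfull⟩, rfl⟩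
    refine mem_integralOnLattice_of_full hσ hfull fun n hn => ?_
    rw [← hu σ hσ _ hn]
    exact hint n

end Lattice

/-! ### Evaluation of function-valued elements at a point -/

section Evaluation

variable {X : Type*}

/-- Evaluation at `x` of a real function or `∞`. -/
def evalTop (x : X) (h : WithTop (X → ℝ)) : WithTop ℝ := h.map fun g => g x

@[simp] lemma evalTop_top (x : X) : evalTop x ⊤ = ⊤ := rfl

@[simp] lemma evalTop_coe (x : X) (g : X → ℝ) : evalTop x (g : WithTop (X → ℝ)) = (g x : ℝ) := rfl

lemma evalTop_eq_top_iff {x : X} {h : WithTop (X → ℝ)} : evalTop x h = ⊤ ↔ h = ⊤ := by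
  cases h <;> simp

lemma evalTop_inf (x : X) (g h : WithTop (X → ℝ)) :
    evalTop x (g ⊓ h) = evalTop x g ⊓ evalTop x h := by
  cases g with
  | top => simp
  | coe g =>
    cases h with
    | top => simp
    | coe h => rfl

lemma evalTop_mono (x : X) : Monotone (evalTop x) := fun g h hgh => by
  rw [← inf_eq_left] at hgh ⊢
  rw [← evalTop_inf, hgh]

/-- At least one point is needed: on an empty set no evaluation separates ∞ from the empty function.
-/
lemma le_of_evalTop_le [Nonempty X] {g h : WithTop (X → ℝ)}
    (H : ∀ x, evalTop x g ≤ evalTop x h) : g ≤ h := by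
  cases h with
  | top => exact le_top
  | coe h =>
    cases g with
    | top => obtain ⟨x⟩ := ‹Nonempty X›; exact absurd (H x) (by simp)
    | coe g => exact WithTop.coe_le_coe.2 fun x => WithTop.coe_le_coe.1 (H x)

lemma eq_of_evalTop_eq [Nonempty X] {g h : WithTop (X → ℝ)}
    (H : ∀ x, evalTop x g = evalTop x h) : g = h :=
  le_antisymm (le_of_evalTop_le fun x => (H x).le) (le_of_evalTop_le fun x => (H x).ge)

end Evaluation

/-! ### Valuations, frames and adapted bases -/

section Valuations

lemma evalAt_eq {E V : Type*} (v : E → WithTop (V → ℝ)) (x : V) (e : E) :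
    evalAt v x e = evalTop x (v e) := rfl

variable {k : Type*} [Field k] {E : Type*} [AddCommGroup E] [Module k E]

/-- The subspace of vectors of value at least `a`. -/
def IsValuation.geSubmodule {Γ : Type*} [SemilatticeInf Γ] [OrderTop Γ] {v : E → Γ}
    (hv : IsValuation k v) (a : Γ) : Submodule k E where
  carrier := {e | a ≤ v e}
  zero_mem' := by
    change a ≤ v 0
    rw [(hv.eq_top_iff 0).2 rfl]; exact le_top
  add_mem' h h' := (le_inf h h').trans (hv.inf_le_map_add _ _)
  smul_mem' c e h := by
    by_cases hc : c = 0
    · subst hc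
      change a ≤ v ((0 : k) • e)
      rw [zero_smul, (hv.eq_top_iff 0).2 rfl]; exact le_top
    · change a ≤ v (c • e)
      rw [hv.map_smul c e hc]; exact h

@[simp] lemma IsValuation.mem_geSubmodule {Γ : Type*} [SemilatticeInf Γ] [OrderTop Γ] {v : E → Γ}
    (hv : IsValuation k v) {a : Γ} {e : E} : e ∈ hv.geSubmodule a ↔ a ≤ v e := Iff.rfl

/-- A finite linear combination has value at least that of one of its terms. -/
lemma IsValuation.exists_le_sum {v : E → WithTop ℝ} (hv : IsValuation k v) {ι : Type*}
    {s : Finset ι} (hs : s.Nonempty) (f : ι → E) : ∃ i ∈ s, v (f i) ≤ v (∑ i ∈ s, f i) := by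
  classical
  induction hs using Finset.Nonempty.cons_induction with
  | singleton i => exact ⟨i, by simp, by simp⟩
  | cons i s hi hs ih =>
    obtain ⟨j, hj, h⟩ := ih
    rw [Finset.sum_cons]
    have := hv.inf_le_map_add (f i) (∑ i ∈ s, f i)
    rcases inf_le_iff.1 this with h' | h'
    · exact ⟨i, by simp, h'⟩
    · exact ⟨j, by simp [hj], h.trans h'⟩

/-- A basis of `E` gives a frame. -/
noncomputable def Frame.ofBasis (b : Module.Basis (Fin (Module.finrank k E)) k E) :
    Frame k E where
  line i := Submodule.span k {b i}
  finrank_line i := finrank_span_singleton (b.ne_zero i)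
  isInternal := by
    refine DirectSum.isInternal_submodule_of_iSupIndep_of_iSup_eq_top
      b.linearIndependent.iSupIndep_span_singleton ?_
    rw [← Submodule.span_range_eq_iSup, b.span_eq]

/-- Every frame comes from a basis. -/
lemma Frame.exists_basis (L : Frame k E) : ∃ b : Module.Basis (Fin (Module.finrank k E)) k E,
    ∀ i, L.line i = Submodule.span k {b i} := by
  have h : ∀ i, ∃ e : E, e ≠ 0 ∧ L.line i = Submodule.span k {e} := by
    intro i
    obtain ⟨⟨e, he⟩, h0, h⟩ := finrank_eq_one_iff'.1 (L.finrank_line i)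
    refine ⟨e, fun h => h0 (Subtype.ext h), le_antisymm (fun w hw => ?_) ?_⟩
    · obtain ⟨c, hc⟩ := h ⟨w, hw⟩
      exact Submodule.mem_span_singleton.2 ⟨c, congrArg Subtype.val hc⟩
    · simpa using he
  choose e he hline using h
  have hmem : ∀ i, e i ∈ L.line i := fun i => by
    rw [hline i]; exact Submodule.mem_span_singleton_self _
  have hli := L.isInternal.submodule_iSupIndep.linearIndependent L.line hmem he
  have hspan : ⊤ ≤ Submodule.span k (Set.range e) := by
    rw [Submodule.span_range_eq_iSup, ← L.isInternal.submodule_iSup_eq_top]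
    exact (iSup_congr hline).le
  exact ⟨Module.Basis.mk hli hspan, fun i => by rw [hline, Module.Basis.mk_apply]⟩

lemma biSup_span_singleton (b : Fin (Module.finrank k E) → E)
    (J : Set (Fin (Module.finrank k E))) :
    (⨆ i ∈ J, Submodule.span k {b i}) = Submodule.span k (b '' J) := by
  rw [Set.image_eq_iUnion, Submodule.span_iUnion₂]

/-- On an apartment, the value of a vector is the minimum of some of the coordinates. -/
lemma Frame.exists_coords (L : Frame k E) {e : E} (he : e ≠ 0) :
    ∃ I : Finset (Fin (Module.finrank k E)), ∀ w ∈ L.apartment,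
      ∀ a, L.HasCoords w a → (∀ i ∈ I, w.1 e ≤ (a i : ℝ)) ∧ ∃ i ∈ I, w.1 e = (a i : ℝ) := by
  obtain ⟨b, hb⟩ := L.exists_basis
  -- The index set depends only on e and the frame, so it serves for all points of the apartment.
  refine ⟨(b.repr e).support, fun w hw a ha => ?_⟩
  have hcoord : ∀ i, ∀ c : k, c ≠ 0 → w.1 (c • b i) = (a i : ℝ) := fun i c hc => by
    refine ha i _ ?_ (smul_ne_zero hc (b.ne_zero i))
    rw [hb i]
    exact Submodule.smul_mem _ _ (Submodule.mem_span_singleton_self _)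
  have hle : ∀ i ∈ (b.repr e).support, w.1 e ≤ (a i : ℝ) := by
    intro i hi
    -- With r the value of e, the vectors of value at least r are spanned by some of the basis
    -- vectors. Since e is among them, so is each basis vector occurring in e.
    obtain ⟨r, hr⟩ := WithTop.ne_top_iff_exists.1 fun h => he ((w.2.eq_top_iff e).1 h)
    obtain ⟨J, hJ⟩ := hw r
    simp only [hb, biSup_span_singleton] at hJ
    have h1 : e ∈ {e : E | (r : WithTop ℝ) ≤ w.1 e} := hr.le
    rw [hJ, SetLike.mem_coe, b.mem_span_image] at h1
    have h2 : b i ∈ {e : E | (r : WithTop ℝ) ≤ w.1 e} := by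
      rw [hJ]; exact Submodule.subset_span ⟨i, h1 hi, rfl⟩
    rw [← hr, ← hcoord i 1 one_ne_zero, one_smul]
    exact h2
  refine ⟨hle, ?_⟩
  have hne : (b.repr e).support.Nonempty := by
    rw [Finsupp.support_nonempty_iff]; simpa using he
  obtain ⟨i, hi, h⟩ := w.2.exists_le_sum hne fun i => b.repr e i • b i
  have hsum : ∑ i ∈ (b.repr e).support, b.repr e i • b i = e := by
    conv_rhs => rw [← b.linearCombination_repr e]
    rfl
  rw [hsum, hcoord i _ (Finsupp.mem_support_iff.1 hi)] at h
  exact ⟨i, hi, le_antisymm (hle i hi) h⟩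

/-- A finite chain of subspaces has an adapted linearly independent set. -/
lemma exists_adapted_linearIndepOn [Module.Finite k E] (s : Finset (Submodule k E))
    (hs : ∀ F ∈ s, ∀ G ∈ s, F ≤ G ∨ G ≤ F) :
    ∃ B : Set E, LinearIndepOn k id B ∧ (∀ b ∈ B, ∃ F ∈ s, b ∈ F) ∧
      ∀ F ∈ s, F ≤ Submodule.span k (B ∩ F) := by
  classical
  -- Subspaces are added by increasing dimension, so the new one contains all earlier ones and the
  -- independent set only has to be extended inside it.
  induction s using Finset.induction_on_max_value (fun F : Submodule k E => Module.finrank k F) with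
  | empty => exact ⟨∅, linearIndepOn_empty k id, by simp, by simp⟩
  | insert G s _ hmax ih =>
    obtain ⟨B, hB, hBs, hspan⟩ := ih fun F hF F' hF' =>
      hs F (Finset.mem_insert_of_mem hF) F' (Finset.mem_insert_of_mem hF')
    have hle : ∀ F ∈ s, F ≤ G := by
      intro F hF
      rcases hs F (Finset.mem_insert_of_mem hF) G (Finset.mem_insert_self _ _) with h | h
      · exact h
      · exact (Submodule.eq_of_le_of_finrank_le h (hmax F hF)).ge
    obtain ⟨B', hB'G, hBB', hG, hB'⟩ := exists_linearIndepOn_id_extension hB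
      (t := (G : Set E)) fun b hb => let ⟨F, hF, h⟩ := hBs b hb; hle F hF h
    refine ⟨B', hB', fun b hb => ⟨G, Finset.mem_insert_self _ _, hB'G hb⟩, fun F hF => ?_⟩
    rcases Finset.mem_insert.1 hF with rfl | hF
    · rw [Set.inter_eq_left.2 hB'G]; exact hG
    · exact (hspan F hF).trans (Submodule.span_mono (Set.inter_subset_inter_left _ hBB'))

/-- A finite chain of subspaces has an adapted basis. -/
lemma exists_adapted_basis [Module.Finite k E] {𝓕 : Set (Submodule k E)} (hfin : 𝓕.Finite)
    (hs : ∀ F ∈ 𝓕, ∀ G ∈ 𝓕, F ≤ G ∨ G ≤ F) :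
    ∃ b : Module.Basis (Fin (Module.finrank k E)) k E,
      ∀ F ∈ 𝓕, F ≤ Submodule.span k (Set.range b ∩ F) := by
  classical
  -- Adding the whole space to the chain makes the independent set span E.
  obtain ⟨B, hB, -, hspan⟩ := exists_adapted_linearIndepOn (insert ⊤ hfin.toFinset) (by
    intro F hF G hG
    simp only [Finset.mem_insert, Set.Finite.mem_toFinset] at hF hG
    rcases hF with rfl | hF
    · exact Or.inr le_top
    rcases hG with rfl | hG
    · exact Or.inl le_top
    exact hs F hF G hG)
  have htop : ⊤ ≤ Submodule.span k (Set.range fun b : B => id (b : E)) := by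
    simpa using hspan ⊤ (Finset.mem_insert_self _ _)
  let b := Module.Basis.mk hB htop
  have : Fintype B := FiniteDimensional.fintypeBasisIndex b
  let e : B ≃ Fin (Module.finrank k E) :=
    Fintype.equivFinOfCardEq (Module.finrank_eq_card_basis b).symm
  refine ⟨b.reindex e, fun F hF => ?_⟩
  have hr : Set.range (b.reindex e) = B := by
    rw [Module.Basis.range_reindex]
    simp [b]
  rw [hr]
  exact hspan F (by simp [hF])

/-- Evaluating a function-valued valuation at a point gives a valuation. -/
lemma isValuation_evalAt {V : Type*} {v : E → WithTop (V → ℝ)} (hv : IsValuation k v) (x : V) :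
    IsValuation k (evalAt v x) where
  map_smul c e hc := by rw [evalAt_eq, evalAt_eq, hv.map_smul c e hc]
  inf_le_map_add e e' := by
    simp only [evalAt_eq, ← evalTop_inf]
    exact evalTop_mono x (hv.inf_le_map_add e e')
  eq_top_iff e := by rw [evalAt_eq, evalTop_eq_top_iff, hv.eq_top_iff]

variable {V : Type*}

lemma valuationOf_zero (Φ : V → ExtBuilding k E) : valuationOf Φ 0 = ⊤ := by
  simp [valuationOf]

/-- Evaluation of `v_Φ` recovers `Φ`. -/
lemma evalAt_valuationOf (Φ : V → ExtBuilding k E) (x : V) (e : E) :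
    evalAt (valuationOf Φ) x e = (Φ x).1 e := by
  rw [evalAt_eq, valuationOf]
  split_ifs with h
  · rw [evalTop_top, ((Φ x).2.eq_top_iff e).2 h]
  · simp

lemma isValuation_valuationOf [Nonempty V] (Φ : V → ExtBuilding k E) :
    IsValuation k (valuationOf Φ) where
  map_smul c e hc := by
    refine eq_of_evalTop_eq fun x => ?_
    rw [← evalAt_eq, ← evalAt_eq, evalAt_valuationOf, evalAt_valuationOf, (Φ x).2.map_smul c e hc]
  inf_le_map_add e e' := by
    refine le_of_evalTop_le fun x => ?_
    rw [evalTop_inf]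
    simp only [← evalAt_eq, evalAt_valuationOf]
    exact (Φ x).2.inf_le_map_add e e'
  eq_top_iff e := by
    obtain ⟨x⟩ := ‹Nonempty V›
    rw [← evalTop_eq_top_iff (x := x), ← evalAt_eq, evalAt_valuationOf, (Φ x).2.eq_top_iff]

end Valuations

/-! ### From piecewise linear maps to finite valuations and back -/

section Correspondence

lemma withInfinity_mono {V : Type*} {F G : Set (V → ℝ)} (h : F ⊆ G) : withInfinity F ⊆ withInfinity G :=
  Set.insert_subset_insert (Set.image_mono h)

variable {V : Type*} [AddCommGroup V] [Module ℝ V]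

/-- Applied to pointwise comparison of coordinates on a cone, where distinct indices may carry equal
functions, so that antisymmetry is not available. -/
lemma exists_forall_rel_of_total {ι : Type*} {r : ι → ι → Prop} (htot : ∀ i j, r i j ∨ r j i)
    (htrans : ∀ i j l, r i j → r j l → r i l) {I : Finset ι} (hI : I.Nonempty) :
    ∃ i ∈ I, ∀ j ∈ I, r i j := by
  induction hI using Finset.Nonempty.cons_induction with
  | singleton i => exact ⟨i, by simp, by simpa using htot i i⟩
  | cons i I _ _ ih =>
    obtain ⟨j, hj, h⟩ := ih
    rcases htot i j with hij | hij
    · refine ⟨i, by simp, fun l hl => ?_⟩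
      rcases Finset.mem_cons.1 hl with rfl | hl
      · exact (htot l l).elim id id
      · exact htrans _ _ _ hij (h l hl)
    · refine ⟨j, by simp [hj], fun l hl => ?_⟩
      rcases Finset.mem_cons.1 hl with rfl | hl
      · exact hij
      · exact h l hl

/-- There are only finitely many functions that agree on each of finitely many cones covering the
space with one of finitely many linear functionals. -/
lemma finite_setOf_eqOn {T : Set (PointedCone ℝ V)} (hT : T.Finite)
    (hcov : ∀ x, ∃ σ ∈ T, x ∈ σ) {G : Set (V →ₗ[ℝ] ℝ)} (hG : G.Finite) :
    {h : V → ℝ | ∀ σ ∈ T, ∃ g ∈ G, ∀ x ∈ σ, h x = g x}.Finite := by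
  have : Finite T := hT
  have : Finite G := hG
  have key : ∀ (h : {h : V → ℝ | ∀ σ ∈ T, ∃ g ∈ G, ∀ x ∈ σ, h x = g x}) (σ : T),
      ∃ g : G, ∀ x ∈ σ.1, h.1 x = g.1 x := fun h σ =>
    let ⟨g, hg, e⟩ := h.2 σ.1 σ.2
    ⟨⟨g, hg⟩, e⟩
  choose f hf using key
  refine Set.finite_coe_iff.1 (Finite.of_injective f fun h h' e =>
    Subtype.ext (funext fun x => ?_))
  obtain ⟨σ, hσ, hx⟩ := hcov x
  rw [hf h ⟨σ, hσ⟩ x hx, hf h' ⟨σ, hσ⟩ x hx, e]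

/-- Every cone of a complete fan lies in a full-dimensional cone of the fan. -/
lemma Fan.IsComplete.exists_le_full [FiniteDimensional ℝ V] {S : Fan V} (hS : S.IsComplete)
    {σ : PointedCone ℝ V} (hσ : σ ∈ S.cones) :
    ∃ τ ∈ S.cones, σ ≤ τ ∧ Submodule.span ℝ (τ : Set V) = ⊤ := by
  obtain ⟨x, hx, hmin⟩ := (S.isPrefan.gen σ hσ).exists_interior
  obtain ⟨τ, hτ, hxτ, hfull⟩ := hS.exists_mem_full x
  exact ⟨τ, hτ, le_of_inf_isFaceOf (S.inf_isFaceOf σ hσ τ hτ).1 hx hmin hxτ, hfull⟩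

lemma Fan.IsSubdivision.isComplete {S S' : Fan V} (h : S'.IsSubdivision S) (hS : S.IsComplete) :
    S'.IsComplete := h.1.trans hS

lemma SignConst.le_or_le {u u' : V →ₗ[ℝ] ℝ} {σ : PointedCone ℝ V} (h : SignConst (u - u') σ) :
    (∀ x ∈ σ, u x ≤ u' x) ∨ ∀ x ∈ σ, u' x ≤ u x :=
  h.symm.imp (fun h x hx => sub_nonpos.1 (h x hx)) (fun h x hx => sub_nonneg.1 (h x hx))

lemma coord_latticeBasis_integral {N : Type*} [AddCommGroup N] [Module.Free ℤ N]
    (i : Module.Free.ChooseBasisIndex ℤ N) :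
    ⇑((latticeBasis N).coord i) ∈ integralOnLattice N := fun n =>
  ⟨(Module.Free.chooseBasis ℤ N).repr n i, by
    simp [latticeBasis, latticePt, Module.Basis.baseChange_repr_tmul]⟩

variable {k : Type*} [Field k] {E : Type*} [AddCommGroup E] [Module k E]
  {N : Type*} [AddCommGroup N]

lemma IsPrefan.isRational {S : Fan (NR N)}
    (h : IsPrefan (Set.range (latticePt (N := N))) S.cones) : S.IsRational :=
  fun σ hσ => generatedIn_range_latticePt_iff.1 (h.gen σ hσ)

lemma Fan.IsRational.isPrefan {S : Fan (NR N)} (h : S.IsRational) :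
    IsPrefan (Set.range (latticePt (N := N))) S.cones :=
  ⟨S.finite, fun σ hσ => generatedIn_range_latticePt_iff.2 (h σ hσ), S.face_mem, S.inf_isFaceOf⟩

lemma inter_integral_mem_withInfinity {Φ : NR N → ExtBuilding k E} (hΦ : IsIntegralMap Φ)
    {F : Set (NR N → ℝ)} {e : E} (he : valuationOf Φ e ∈ withInfinity F) :
    valuationOf Φ e ∈ withInfinity (F ∩ integralOnLattice N) := by
  rcases he with he | ⟨h, hF, he⟩
  · exact Or.inl he
  · refine Or.inr ⟨h, ⟨hF, fun n => ?_⟩, he⟩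
    have h1 : (Φ (latticePt n)).1 e = (h (latticePt n) : ℝ) := by
      rw [← evalAt_valuationOf, evalAt_eq, ← he]; rfl
    rcases hΦ n e with h2 | ⟨m, hm⟩
    · rw [h2] at h1; exact absurd h1 (by simp)
    · rw [hm] at h1
      exact ⟨m, (WithTop.coe_injective h1).symm⟩

lemma isIntegralMap_iff {Φ : NR N → ExtBuilding k E}
    (hΦ : ∀ e, valuationOf Φ e ∈ withInfinity (PL (NR N))) :
    IsIntegralMap Φ ↔ IsIntegralValuation (valuationOf Φ) := by
  refine ⟨fun h e => inter_integral_mem_withInfinity h (hΦ e), fun h n e => ?_⟩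
  rw [← evalAt_valuationOf, evalAt_eq]
  rcases h e with h' | ⟨g, hg, h'⟩
  · exact Or.inl (by rw [h', evalTop_top])
  · obtain ⟨m, hm⟩ := hg.2 n
    exact Or.inr ⟨m, by rw [← h', ← hm]; rfl⟩

variable [Module.Free ℤ N] [Module.Finite ℤ N]

/-- The coordinates of an integral piecewise linear map on a full-dimensional cone are integral. -/
lemma integral_coord {S : Fan (NR N)} {Φ : NR N → ExtBuilding k E} (hΦ : IsIntegralMap Φ)
    {σ : PointedCone ℝ (NR N)} (hσ : σ ∈ S.cones)
    (hfull : Submodule.span ℝ (σ : Set (NR N)) = ⊤) {L : Frame k E}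
    {u : NR N →ₗ[ℝ] (Fin (Module.finrank k E) → ℝ)} (hu : ∀ x ∈ σ, L.HasCoords (Φ x) (u x))
    (i : Fin (Module.finrank k E)) :
    ⇑((LinearMap.proj i : (Fin (Module.finrank k E) → ℝ) →ₗ[ℝ] ℝ) ∘ₗ u) ∈
      integralOnLattice N := by
  refine mem_integralOnLattice_of_full hσ hfull fun n hn => ?_
  obtain ⟨b, hb⟩ := L.exists_basis
  have h := hu _ hn i (b i) (by rw [hb i]; exact Submodule.mem_span_singleton_self _) (b.ne_zero i)
  rcases hΦ n (b i) with h' | ⟨m, hm⟩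
  · rw [h'] at h; exact absurd h (by simp)
  · rw [hm] at h
    exact ⟨m, (WithTop.coe_injective h).symm⟩

variable [Module.Finite k E]

/-- The valuation of a piecewise linear map is piecewise linear with respect to a subdivision. -/
lemma exists_subdivision {S : Fan (NR N)} {Φ : NR N → ExtBuilding k E} (hS : S.IsComplete)
    (hΦ : IsPLMapOn S Φ) :
    (Set.range (valuationOf Φ)).Finite ∧ ∃ S' : Fan (NR N), S'.IsSubdivision S ∧
      (∀ e, valuationOf Φ e ∈ withInfinity (PLOn S')) ∧
      (IsIntegralMap Φ → S.IsRational → S'.IsRational) := by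
  have : Nonempty (Frame k E) := ⟨Frame.ofBasis (Module.finBasis k E)⟩
  choose! L hL u hu using hΦ
  let full : Set (PointedCone ℝ (NR N)) :=
    {σ ∈ S.cones | Submodule.span ℝ (σ : Set (NR N)) = ⊤}
  let coord : PointedCone ℝ (NR N) → Fin (Module.finrank k E) → NR N →ₗ[ℝ] ℝ :=
    fun σ i => LinearMap.proj i ∘ₗ u σ
  -- Coordinates are taken from full-dimensional cones only, because integrality is available there;
  -- every cone of the fan lies in such a cone.
  let G : Set (NR N →ₗ[ℝ] ℝ) := Set.image2 coord full Set.univ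
  have hG : G.Finite := (S.finite.subset (Set.sep_subset _ _)).image2 _ Set.finite_univ
  obtain ⟨T, hT, hsupp, hsub, hsign, hrat⟩ :=
    S.isPrefan.exists_refine (hG.image2 (· - ·) hG)
  have hlin : ∀ e, e ≠ 0 → ∀ σ ∈ T, ∃ g ∈ G, ∀ x ∈ σ, (Φ x).1 e = (g x : ℝ) := by
    intro e he σ' hσ'
    obtain ⟨σ, hσ, hσσ⟩ := hsub σ' hσ'
    obtain ⟨τ, hτ, hστ, hfull⟩ := hS.exists_le_full hσ
    have hle := hσσ.trans hστ
    obtain ⟨I, hI⟩ := (L τ).exists_coords he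
    have hI' := fun x (hx : x ∈ σ') => hI _ (hL τ hτ x (hle hx)) _ (hu τ hτ x (hle hx))
    have hne : I.Nonempty := by
      obtain ⟨i, hi, -⟩ := (hI' 0 (zero_mem _)).2
      exact ⟨i, hi⟩
    -- After the cut, one coordinate in I is the smallest on the whole cone, and the value of e, a
    -- minimum over I, equals it.
    obtain ⟨i, hi, hmin⟩ := exists_forall_rel_of_total
      (r := fun i j => ∀ x ∈ σ', coord τ i x ≤ coord τ j x)
      (fun i j => (hsign _ ⟨_, ⟨τ, ⟨hτ, hfull⟩, i, trivial, rfl⟩, _,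
        ⟨τ, ⟨hτ, hfull⟩, j, trivial, rfl⟩, rfl⟩ σ' hσ').le_or_le)
      (fun i j l h h' x hx => (h x hx).trans (h' x hx)) hne
    refine ⟨_, ⟨τ, ⟨hτ, hfull⟩, i, trivial, rfl⟩, fun x hx => ?_⟩
    obtain ⟨h1, j, hj, h2⟩ := hI' x hx
    refine le_antisymm (h1 i hi) ?_
    rw [h2]
    exact WithTop.coe_le_coe.2 (hmin j hj x hx)
  have hval : ∀ e, e ≠ 0 → ∃ h : NR N → ℝ, valuationOf Φ e = h ∧
      ∀ σ ∈ T, ∃ g ∈ G, ∀ x ∈ σ, h x = g x := by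
    intro e he
    obtain ⟨h, hh⟩ := WithTop.ne_top_iff_exists.1
      fun h => he (((isValuation_valuationOf Φ).eq_top_iff e).1 h)
    refine ⟨h, hh.symm, fun σ hσ => ?_⟩
    obtain ⟨g, hg, hgx⟩ := hlin e he σ hσ
    refine ⟨g, hg, fun x hx => WithTop.coe_injective ?_⟩
    rw [← hgx x hx, ← evalAt_valuationOf, evalAt_eq, ← hh, evalTop_coe]
  let S' : Fan (NR N) := hT.toFan fun σ' hσ' x hx hx' => by
    obtain ⟨σ, hσ, hle⟩ := hsub σ' hσ'
    exact S.salient σ hσ x (hle hx) (hle hx')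
  have hS' : S'.IsSubdivision S := ⟨hsupp, hsub⟩
  refine ⟨?_, S', hS', fun e => ?_, fun hint hSrat => ?_⟩
  · refine (((finite_setOf_eqOn hT.finite (hS'.isComplete hS).exists_mem hG).image
      fun h : NR N → ℝ => (h : WithTop (NR N → ℝ))).insert ⊤).subset ?_
    rintro _ ⟨e, rfl⟩
    by_cases he : e = 0
    · subst he; exact Or.inl (valuationOf_zero Φ)
    · obtain ⟨h, hh, hhT⟩ := hval e he
      exact Or.inr ⟨h, hhT, hh.symm⟩
  · by_cases he : e = 0
    · subst he; exact Or.inl (valuationOf_zero Φ)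
    · obtain ⟨h, hh, hhT⟩ := hval e he
      exact Or.inr ⟨h, fun σ hσ => let ⟨g, _, hg⟩ := hhT σ hσ; ⟨g, hg⟩, hh.symm⟩
  · have hGint : ∀ g ∈ G, ⇑g ∈ integralOnLattice N := by
      rintro _ ⟨σ, ⟨hσ, hfull⟩, i, -, rfl⟩
      exact integral_coord hint hσ hfull (hu σ hσ) i
    refine IsPrefan.isRational (hrat _ ?_ hSrat.isPrefan)
    rintro _ ⟨g, hg, g', hg', rfl⟩
    have := sub_mem_integralOnLattice (hGint g hg) (hGint g' hg')
    exact ⟨eliminationClosed_of_integral this,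
      eliminationClosed_of_integral (neg_mem_integralOnLattice this)⟩

lemma isFinitePLValuation_valuationOf {S : Fan (NR N)} {Φ : NR N → ExtBuilding k E}
    (hS : S.IsComplete) (hΦ : IsPLMapOn S Φ) : IsFinitePLValuation k (valuationOf Φ) := by
  obtain ⟨hfin, S', hS', hval, -⟩ := exists_subdivision hS hΦ
  exact ⟨isValuation_valuationOf Φ, fun e => withInfinity_mono
    (show PLOn S' ⊆ PL (NR N) from fun h hh => ⟨S', hS'.isComplete hS, hh⟩) (hval e), hfin.infClosure⟩

/-- The prefan consisting of the whole space. -/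
lemma isPrefan_top (N : Type*) [AddCommGroup N] [Module.Free ℤ N] [Module.Finite ℤ N] :
    IsPrefan (Set.range (latticePt (N := N))) {(⊤ : PointedCone ℝ (NR N))} where
  finite := Set.finite_singleton _
  gen := by
    classical
    rintro _ rfl
    let b := latticeBasis N
    refine ⟨Finset.univ.image b ∪ Finset.univ.image fun i => -b i, ?_, ?_⟩
    · intro x hx
      rcases Finset.mem_union.1 hx with h | h <;> obtain ⟨i, -, rfl⟩ := Finset.mem_image.1 h
      · exact ⟨_, (latticeBasis_apply N i).symm⟩
      · exact ⟨-Module.Free.chooseBasis ℤ N i, by rw [latticePt_neg, ← latticeBasis_apply]⟩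
    · refine (top_le_iff.1 fun x _ => ?_).symm
      rw [← b.sum_repr x]
      refine Submodule.sum_mem _ fun i _ => ?_
      rcases le_total 0 (b.repr x i) with h | h
      · exact PointedCone.smul_mem _ h (Submodule.subset_span (by simp))
      · rw [← neg_smul_neg]
        exact PointedCone.smul_mem _ (neg_nonneg.2 h) (Submodule.subset_span (by simp))
  face_mem := by
    rintro _ rfl τ hτ
    exact top_le_iff.1 fun x _ => hτ.mem_of_add_mem_left (x := x) (y := -x) trivial trivial
      (by simp)
  inf_isFaceOf := by
    rintro _ rfl _ rfl
    simp

/-- On a cone on which the values of a valuation are linear and totally ordered, the valuation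
lies in one apartment. -/
lemma exists_frame {v : E → WithTop (V → ℝ)} (hv : IsValuation k v) (hfin : (Set.range v).Finite)
    {C : PointedCone ℝ V}
    (hlin : ∀ e, e ≠ 0 → ∃ u : V →ₗ[ℝ] ℝ, ∀ x ∈ C, evalAt v x e = (u x : ℝ))
    (htot : ∀ e e', (∀ x ∈ C, evalAt v x e ≤ evalAt v x e') ∨
      ∀ x ∈ C, evalAt v x e' ≤ evalAt v x e) :
    ∃ L : Frame k E, (∀ x ∈ C, (⟨evalAt v x, isValuation_evalAt hv x⟩ : ExtBuilding k E) ∈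
      L.apartment) ∧ ∃ u : V →ₗ[ℝ] (Fin (Module.finrank k E) → ℝ), ∀ x ∈ C,
        L.HasCoords (⟨evalAt v x, isValuation_evalAt hv x⟩ : ExtBuilding k E) (u x) := by
  -- F h consists of the vectors whose value is at least h on all of C. For h in the range of v
  -- these subspaces form a finite chain, and the adapted basis does not depend on the point x.
  let F : WithTop (V → ℝ) → Submodule k E := fun h =>
    ⨅ x ∈ C, (isValuation_evalAt hv x).geSubmodule (evalTop x h)
  have hF : ∀ h e, e ∈ F h ↔ ∀ x ∈ C, evalTop x h ≤ evalAt v x e := fun h e => by simp [F]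
  obtain ⟨b, hb⟩ := exists_adapted_basis (k := k) (hfin.image F) (by
    rintro _ ⟨_, ⟨e, rfl⟩, rfl⟩ _ ⟨_, ⟨e', rfl⟩, rfl⟩
    rcases htot e e' with h | h
    · exact Or.inr fun f hf => (hF _ _).2 fun x hx => (h x hx).trans ((hF _ _).1 hf x hx)
    · exact Or.inl fun f hf => (hF _ _).2 fun x hx => (h x hx).trans ((hF _ _).1 hf x hx))
  refine ⟨Frame.ofBasis b, fun x hx a => ?_, ?_⟩
  · refine ⟨{i | (a : WithTop ℝ) ≤ evalAt v x (b i)}, ?_⟩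
    have hmem : ∀ e, e ∈ Submodule.span k
        (b '' {i | (a : WithTop ℝ) ≤ evalAt v x (b i)}) ↔ (a : WithTop ℝ) ≤ evalAt v x e := by
      intro e
      constructor
      · have : Submodule.span k (b '' {i | (a : WithTop ℝ) ≤ evalAt v x (b i)}) ≤
            (isValuation_evalAt hv x).geSubmodule (a : WithTop ℝ) := by
          rw [Submodule.span_le]
          rintro _ ⟨i, hi, rfl⟩
          exact hi
        exact fun h => this h
      · intro h
        have he : e ∈ F (v e) := (hF _ _).2 fun y _ => le_rfl
        refine Submodule.span_mono ?_ (hb _ ⟨v e, ⟨e, rfl⟩, rfl⟩ he)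
        rintro _ ⟨⟨i, rfl⟩, hi⟩
        exact ⟨i, h.trans ((hF _ _).1 hi x hx), rfl⟩
    change {e | (a : WithTop ℝ) ≤ evalAt v x e} = ((⨆ i ∈ _, Submodule.span k {b i} :
      Submodule k E) : Set E)
    rw [biSup_span_singleton]
    exact Set.ext fun e => (hmem e).symm
  · choose u hu using fun i => hlin (b i) (b.ne_zero i)
    refine ⟨LinearMap.pi u, fun x hx i e he he0 => ?_⟩
    obtain ⟨c, rfl⟩ := Submodule.mem_span_singleton.1 he
    have hc : c ≠ 0 := fun h => he0 (by simp [h])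
    change evalAt v x (c • b i) = _
    rw [(isValuation_evalAt hv x).map_smul c _ hc, hu i x hx]
    rfl

/-- A finite piecewise linear valuation defines a piecewise linear map to the extended building. -/
lemma exists_fan_evalAt {v : E → WithTop (NR N → ℝ)} (hv : IsFinitePLValuation k v) :
    ∃ S : Fan (NR N), S.IsComplete ∧
      IsPLMapOn S (fun x => (⟨evalAt v x, isValuation_evalAt hv.isValuation x⟩ :
        ExtBuilding k E)) ∧
      (IsIntegralValuation v → S.IsRational) := by
  have hfin : (Set.range v).Finite := hv.finite.subset subset_infClosure
  let R : Set (NR N → ℝ) := {h | ∃ e, v e = h}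
  have hR : R.Finite := by
    refine Set.Finite.of_finite_image (f := fun h : NR N → ℝ => (h : WithTop (NR N → ℝ))) (hfin.subset ?_)
      WithTop.coe_injective.injOn
    rintro _ ⟨h, ⟨e, he⟩, rfl⟩
    exact ⟨e, he⟩
  have hRPL : ∀ h ∈ R, h ∈ PL (NR N) := by
    rintro h ⟨e, he⟩
    rcases hv.mem_PL e with h' | ⟨g, hg, h'⟩
    · rw [he] at h'; exact absurd h' (by simp)
    · rw [he] at h'
      exact WithTop.coe_injective h' ▸ hg
  have key := fun h hh => exists_functionals_of_mem_PL (hRPL h hh)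
  choose! U hUfin hUval hUint hUcont using key
  -- The functionals of all values are pooled, so that the cut orders different values against each
  -- other and not only the pieces of a single value.
  let W : Set (NR N →ₗ[ℝ] ℝ) := ⋃ h ∈ R, U h
  have hW : W.Finite := hR.biUnion hUfin
  have hsubW : ∀ h ∈ R, U h ⊆ W := fun h hh => Set.subset_biUnion_of_mem hh
  -- Cutting also along the coordinate hyperplanes makes every cone strictly convex: if x and -x
  -- both lie in it, all coordinates of x vanish. These functionals are integral, so rationality is
  -- not affected.
  obtain ⟨T, hT, hsupp, -, hsign, hrat⟩ := ((isPrefan_top N).mono (Set.subset_univ _)).exists_refine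
    ((hW.image2 (· - ·) hW).union (Set.finite_range (latticeBasis N).coord))
  have hsignW : ∀ σ ∈ T, ∀ u ∈ W, ∀ u' ∈ W, SignConst (u - u') σ := fun σ hσ u hu u' hu' =>
    hsign _ (Or.inl ⟨u, hu, u', hu', rfl⟩) σ hσ
  have hlin : ∀ σ ∈ T, ∀ h ∈ R, ∃ u ∈ W, ∀ x ∈ σ, h x = u x := by
    intro σ hσ h hh
    obtain ⟨u, hu, e⟩ := exists_eqOn_of_signConst (hT.gen σ hσ) (hUfin h hh)
      (fun u hu u' hu' => hsignW σ hσ u (hsubW h hh hu) u' (hsubW h hh hu'))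
      (hUval h hh) (hUcont h hh)
    exact ⟨u, hsubW h hh hu, e⟩
  have hev : ∀ σ ∈ T, ∀ e, e ≠ 0 → ∃ u ∈ W, ∀ x ∈ σ, evalAt v x e = (u x : ℝ) := by
    intro σ hσ e he
    obtain ⟨h, hh⟩ := WithTop.ne_top_iff_exists.1
      fun h => he ((hv.isValuation.eq_top_iff e).1 h)
    obtain ⟨u, hu, hux⟩ := hlin σ hσ h ⟨e, hh.symm⟩
    exact ⟨u, hu, fun x hx => by rw [evalAt_eq, ← hh, evalTop_coe, hux x hx]⟩
  have htop : ∀ x, evalAt v x 0 = ⊤ := fun x =>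
    ((isValuation_evalAt hv.isValuation x).eq_top_iff 0).2 rfl
  refine ⟨hT.toFan ?_, ?_, fun σ hσ => ?_, fun hint => ?_⟩
  · intro σ hσ x hx hx'
    refine (latticeBasis N).ext_elem fun i => ?_
    have h : ∀ y ∈ σ, -y ∈ σ → (latticeBasis N).coord i y = 0 := by
      intro y hy hy'
      rcases hsign _ (Or.inr ⟨i, rfl⟩) σ hσ with hs | hs
      · have h1 := hs y hy
        have h2 := hs _ hy'
        rw [map_neg] at h2
        linarith
      · have h1 := hs y hy
        have h2 := hs _ hy'
        rw [map_neg] at h2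
        linarith
    simpa using h x hx hx'
  · rw [Fan.IsComplete]
    change (⋃ σ ∈ T, (σ : Set (NR N))) = _
    rw [hsupp]; simp
  · refine exists_frame hv.isValuation hfin
      (fun e he => let ⟨u, _, hu⟩ := hev σ hσ e he; ⟨u, hu⟩) fun e e' => ?_
    by_cases he : e = 0
    · subst he; exact Or.inr fun x _ => by rw [htop]; exact le_top
    by_cases he' : e' = 0
    · subst he'; exact Or.inl fun x _ => by rw [htop]; exact le_top
    obtain ⟨u, hu, hux⟩ := hev σ hσ e he
    obtain ⟨u', hu', hux'⟩ := hev σ hσ e' he'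
    refine (hsignW σ hσ u hu u' hu').le_or_le.imp (fun h x hx => ?_) (fun h x hx => ?_) <;>
      rw [hux x hx, hux' x hx] <;> exact WithTop.coe_le_coe.2 (h x hx)
  · have hWint : ∀ u ∈ W, ⇑u ∈ integralOnLattice N := by
      intro u hu
      obtain ⟨h, hh, hu⟩ := Set.mem_iUnion₂.1 hu
      refine hUint h hh ?_ u hu
      obtain ⟨e, he⟩ := hh
      rcases hint e with h' | ⟨g, hg, h'⟩
      · rw [he] at h'; exact absurd h' (by simp)
      · rw [he] at h'
        exact WithTop.coe_injective h' ▸ hg.2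
    refine IsPrefan.isRational (hrat _ (fun l hl => ?_) (isPrefan_top N))
    have : ⇑l ∈ integralOnLattice N := by
      rcases hl with ⟨u, hu, u', hu', rfl⟩ | ⟨i, rfl⟩
      · exact sub_mem_integralOnLattice (hWint u hu) (hWint u' hu')
      · exact coord_latticeBasis_integral i
    exact ⟨eliminationClosed_of_integral this,
      eliminationClosed_of_integral (neg_mem_integralOnLattice this)⟩

end Correspondence

end ToricPL

open ToricPL in
theorem mainTheorem3 (k : Type*) [Field k] (E : Type*) [AddCommGroup E] [Module k E]
    [Module.Finite k E] (N : Type*) [AddCommGroup N] [Module.Free ℤ N] [Module.Finite ℤ N] :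
    -- (1) `v_Φ` is a finite piecewise linear valuation, with values in `PL(Σ', ℝ)` for one
    -- subdivision `Σ'` of `Σ`, and in `PL(Σ', ℤ)` if `Φ` is integral
    (∀ (S : Fan (NR N)) (Φ : NR N → ExtBuilding k E), S.IsComplete → IsPLMapOn S Φ →
      IsFinitePLValuation k (valuationOf Φ) ∧
      ∃ S' : Fan (NR N), S'.IsSubdivision S ∧
        (∀ e, valuationOf Φ e ∈ withInfinity (PLOn S')) ∧
        (IsIntegralMap Φ → ∀ e, valuationOf Φ e ∈ withInfinity (PLOnInt S')) ∧
        (IsIntegralMap Φ → S.IsRational → S'.IsRational)) ∧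
    -- (2) `Φ_v` is a well-defined map to the extended building, piecewise linear with respect to
    -- a complete fan, which can be taken rational if `v` is integral
    (∀ v : E → WithTop (NR N → ℝ), IsFinitePLValuation k v →
      ∃ hv : ∀ x, IsValuation k (evalAt v x),
      ∃ S : Fan (NR N), S.IsComplete ∧
        IsPLMapOn S (fun x => (⟨evalAt v x, hv x⟩ : ExtBuilding k E)) ∧
        (IsIntegralValuation v → S.IsRational)) ∧
    -- (3) `Φ ↦ v_Φ` and `v ↦ Φ_v` are mutually inverse bijections, and they match the integral
    -- maps with the integral valuations
    (∃ F : {Φ : NR N → ExtBuilding k E // IsPLMap Φ} ≃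
        {v : E → WithTop (NR N → ℝ) // IsFinitePLValuation k v},
      (∀ Φ, (F Φ).1 = valuationOf Φ.1) ∧
      (∀ v x, ((F.symm v).1 x).1 = evalAt v.1 x) ∧
      (∀ Φ, IsIntegralMap Φ.1 ↔ IsIntegralValuation (F Φ).1)) := by
  refine ⟨fun S Φ hS hΦ => ?_, fun v hv => ?_, ?_⟩
  · obtain ⟨-, S', hS', hval, hrat⟩ := exists_subdivision hS hΦ
    exact ⟨isFinitePLValuation_valuationOf hS hΦ, S', hS', hval,
      fun hint e => inter_integral_mem_withInfinity hint (hval e), hrat⟩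
  · exact ⟨isValuation_evalAt hv.isValuation, exists_fan_evalAt hv⟩
  · have hPL : ∀ Φ : {Φ : NR N → ExtBuilding k E // IsPLMap Φ},
        IsFinitePLValuation k (valuationOf Φ.1) := fun ⟨Φ, S, hS, hΦ⟩ =>
      isFinitePLValuation_valuationOf hS hΦ
    refine ⟨{ toFun := fun Φ => ⟨valuationOf Φ.1, hPL Φ⟩
              invFun := fun v => ⟨fun x => ⟨evalAt v.1 x, isValuation_evalAt v.2.isValuation x⟩,
                let ⟨S, hS, h, _⟩ := exists_fan_evalAt v.2
                ⟨S, hS, h⟩⟩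
              left_inv := fun Φ => Subtype.ext <| funext fun x => Subtype.ext <| funext fun e =>
                evalAt_valuationOf Φ.1 x e
              right_inv := fun v => Subtype.ext <| funext fun e => eq_of_evalTop_eq fun x => ?_ },
      fun Φ => rfl, fun v x => rfl, fun Φ => isIntegralMap_iff (hPL Φ).mem_PL⟩
    rw [← evalAt_eq, ← evalAt_eq, evalAt_valuationOf]
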